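/- **Conventions.** For a $k\times k$ matrix $A=(a_{ij})$ of zeros and ones, let $X_A=\{(x_n)_{n\ge1}\in\{1,\dots,k\}^{\mathbb N}: a_{x_nx_{n+1}}=1 \text{ for all } n\}$ with the shift $\sigma$, let $[x_1\dots x_n]$ denote cylinder sets, and $S_nf=\sum_{i<n}f\circ\sigma^i$. The shift $X_A$ is irreducible if for all allowable words $u,v$ there is an allowable word $w$ with $uwv$ allowable. A $\sigma$-invariant Borel probability measure $\nu$ is an *invariant weak Gibbs measure* for a real function $g$ if there are $P\in\mathbb R$ and $C_n>0$ with $\frac1n\log C_n\to0$ such that $C_n^{-1}\le \nu[x_1\dots x_n]/e^{-nP+(S_ng)(x)}\le C_n$ for all points $x$ and all $n\ge1$; it is an *invariant Gibbs measure* for $g$ if $C_n$ can be taken independent of $n$. A sequence $\{\log f_n\}_{n\ge1}$ with $f_n>0$ is *weakly almost additive* if there are $C_n>0$ with $\frac1nC_n\to0$ such that $e^{-C_n}f_n(x)f_m(\sigma^nx)\le f_{n+m}(x)\le e^{C_n}f_n(x)f_m(\sigma^nx)$ for all $x$ and all $n,m\ge1$; it is *almost additive* if $C_n$ can be taken independent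 of $n$. **Setting.** Let $X=X_A\subseteq\{1,2,3\}^{\mathbb N}$ be an irreducible shift of finite type, let $Y=X_B\subseteq\{1,2\}^{\mathbb N}$ with $B=\begin{pmatrix}1&1\\1&1\end{pmatrix}$ (the full shift) or $B=\begin{pmatrix}0&1\\1&1\end{pmatrix}$, and let $\pi:X\to Y$ be a (surjective) one-block factor map with $\pi(1)=1$, $\pi(2)=\pi(3)=2$. Let $f:X\to\mathbb R$ depend only on the first two coordinates, and write $f[ij]$ for its value on $[ij]$. For $y\in Y$ and $n\ge1$ let $g_n(y)=\sup\sum_{x\in E_n(y)}e^{(S_nf)(x)}$, the supremum being over all sets $E_n(y)$ consisting of exactly one point from each nonempty cylinder $[x_1\dots x_n]$ of $X$ with $\pi(x_1\dots x_n)=y_1\dots y_n$, and let $\mathcal G=\{\log g_n\}_{n\ge1}$ (the sequence on $Y$ associated to the relative pressure function $P(\sigma_X,\pi,f)$). Let $M$ be the $3\times3$ matrix with $M(i,j)=e^{f[ij]}$ if $ij$ is an allowable block of $X$ and $M(i,j)=0$ otherwise, and let $M_{22}|_{\pi^{-1}(22)}=(M(i,j))_{i,j\in\{2,3\}}$. Let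 $\mu$ be an invariant Gibbs measure for $f$ and let $\pi\mu=\mu\circ\pi^{-1}$. **Theorem.** The following hold. (i) $\mathcal G$ is almost additive on $Y$ if and only if there is a Borel measurable function $\hat g:Y\to\mathbb R$ for which $\pi\mu$ is the unique invariant Gibbs measure. If $\mathcal G$ is weakly almost additive on $Y$, then there is a Borel measurable function $\hat g:Y\to\mathbb R$ for which $\pi\mu$ is the unique invariant weak Gibbs measure. (ii) If $M_{22}|_{\pi^{-1}(22)}$ is not of the form $\begin{pmatrix}0&a_1\\a_2&0\end{pmatrix}$ with $a_1,a_2>0$, then both statements of (i) hold with "Borel measurable" replaced by "continuous". (iii) If $M_{22}|_{\pi^{-1}(22)}=\begin{pmatrix}0&a_1\\a_1&0\end{pmatrix}$ for some $a_1>0$, and $M(2,1)=M(3,1)$ or $M(1,2)=M(1,3)$, then both statements of (i) hold with "Borel measurable" replaced by "continuous". -/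

import Mathlib

open MeasureTheory Filter Topology

noncomputable section

namespace GibbsFactor

/-! ### One-sided shifts of finite type

Sequences are indexed by `ℕ` starting at `0`, so the first coordinate of `x` is `x 0`; the symbols
`1, …, k` are the elements `0, …, k - 1` of `Fin k`. -/

/-- The one-sided shift of finite type `X_A` with transition matrix `A`. -/
def SFT {k : ℕ} (A : Matrix (Fin k) (Fin k) ℕ) : Set (ℕ → Fin k) :=
  {x | ∀ n, A (x n) (x (n + 1)) = 1}

/-- `A` is a matrix of zeros and ones. -/
def IsZeroOne {k : ℕ} (A : Matrix (Fin k) (Fin k) ℕ) : Prop :=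
  ∀ i j, A i j = 0 ∨ A i j = 1

/-- The language of a set of sequences: all finite words that appear in its points. -/
def language {k : ℕ} (X : Set (ℕ → Fin k)) : Set (List (Fin k)) :=
  {w | ∃ x ∈ X, ∃ m : ℕ, ∀ (i : ℕ) (h : i < w.length), x (m + i) = w[i]}

/-- Irreducibility: any two allowable words can be joined by an allowable word. -/
def IsIrreducibleShift {k : ℕ} (X : Set (ℕ → Fin k)) : Prop :=
  ∀ u ∈ language X, ∀ v ∈ language X, ∃ w ∈ language X, u ++ w ++ v ∈ language X

/-- The shift map on a shift of finite type. -/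
def shift {k : ℕ} (A : Matrix (Fin k) (Fin k) ℕ) (x : SFT A) : SFT A :=
  ⟨fun n => x.1 (n + 1), fun n => x.2 (n + 1)⟩

/-- The cylinder set `[x_1 … x_n]` of the first `n` symbols of the point `x`. -/
def cyl {k : ℕ} {A : Matrix (Fin k) (Fin k) ℕ} (n : ℕ) (x : SFT A) : Set (SFT A) :=
  {z | ∀ i < n, z.1 i = x.1 i}

/-- `π : X_A → X_B` is a factor map which is a one-block code with symbol map `c`. -/
structure IsOneBlockFactorMap {k l : ℕ} {A : Matrix (Fin k) (Fin k) ℕ}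
    {B : Matrix (Fin l) (Fin l) ℕ} (c : Fin k → Fin l) (π : SFT A → SFT B) : Prop where
  continuous : Continuous π
  surjective : Function.Surjective π
  semiconj : Function.Semiconj π (shift A) (shift B)
  oneBlock : ∀ x n, (π x).1 n = c (x.1 n)

/-! ### Gibbs and weak Gibbs measures for a function -/

section Gibbs

variable {k : ℕ} {A : Matrix (Fin k) (Fin k) ℕ}

/-- `ν` is a shift-invariant Borel probability measure. -/
def IsInvariantProb (ν : Measure (SFT A)) : Prop :=
  IsProbabilityMeasure ν ∧ MeasurePreserving (shift A) ν ν

/-- The Gibbs inequality at `x` and `n` with constants `P` and `C`. -/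
def GibbsBound (ν : Measure (SFT A)) (g : SFT A → ℝ) (P C : ℝ) (n : ℕ) (x : SFT A) : Prop :=
  1 / C ≤ ν.real (cyl n x) / (Real.exp (-(n * P)) * Real.exp (birkhoffSum (shift A) g n x)) ∧
  ν.real (cyl n x) / (Real.exp (-(n * P)) * Real.exp (birkhoffSum (shift A) g n x)) ≤ C

/-- `ν` is an invariant Gibbs measure for `g`. -/
def IsInvariantGibbs (ν : Measure (SFT A)) (g : SFT A → ℝ) : Prop :=
  IsInvariantProb ν ∧ ∃ P C : ℝ, 0 < C ∧
    ∀ (x : SFT A) (n : ℕ), 1 ≤ n → GibbsBound ν g P C n x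

/-- `ν` is an invariant weak Gibbs measure for `g`: the constants may grow subexponentially. -/
def IsInvariantWeakGibbs (ν : Measure (SFT A)) (g : SFT A → ℝ) : Prop :=
  IsInvariantProb ν ∧ ∃ (P : ℝ) (C : ℕ → ℝ), (∀ n, 1 ≤ n → 0 < C n) ∧
    Tendsto (fun n : ℕ => (1 / (n : ℝ)) * Real.log (C n)) atTop (𝓝 0) ∧
    ∀ (x : SFT A) (n : ℕ), 1 ≤ n → GibbsBound ν g P (C n) n x

/-- `ν` is the one and only invariant Gibbs measure for `g`. -/
def IsUniqueInvariantGibbs (ν : Measure (SFT A)) (g : SFT A → ℝ) : Prop :=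
  IsInvariantGibbs ν g ∧ ∀ ν' : Measure (SFT A), IsInvariantGibbs ν' g → ν' = ν

/-- `ν` is the one and only invariant weak Gibbs measure for `g`. -/
def IsUniqueInvariantWeakGibbs (ν : Measure (SFT A)) (g : SFT A → ℝ) : Prop :=
  IsInvariantWeakGibbs ν g ∧ ∀ ν' : Measure (SFT A), IsInvariantWeakGibbs ν' g → ν' = ν

/-! ### Almost additivity of a sequence `{log F_n}_{n ≥ 1}` -/

/-- The two almost additivity inequalities at `n, m, x` with constant `C`. -/
def AdditivityBound (F : ℕ → SFT A → ℝ) (C : ℝ) (n m : ℕ) (x : SFT A) : Prop :=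
  F (n + m) x ≤ Real.exp C * F n x * F m ((shift A)^[n] x) ∧
  Real.exp (-C) * F n x * F m ((shift A)^[n] x) ≤ F (n + m) x

/-- `{log F_n}` is almost additive. -/
def AlmostAdditive (F : ℕ → SFT A → ℝ) : Prop :=
  ∃ C : ℝ, 0 < C ∧ ∀ (x : SFT A) (n m : ℕ), 1 ≤ n → 1 ≤ m → AdditivityBound F C n m x

/-- `{log F_n}` is weakly almost additive. -/
def WeaklyAlmostAdditive (F : ℕ → SFT A → ℝ) : Prop :=
  ∃ C : ℕ → ℝ, (∀ n, 1 ≤ n → 0 < C n) ∧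
    Tendsto (fun n : ℕ => (1 / (n : ℝ)) * C n) atTop (𝓝 0) ∧
    ∀ (x : SFT A) (n m : ℕ), 1 ≤ n → 1 ≤ m → AdditivityBound F (C n) n m x

end Gibbs

/-! ### The sequence associated to the relative pressure function -/

section Relative

variable {k l : ℕ} {A : Matrix (Fin k) (Fin k) ℕ} {B : Matrix (Fin l) (Fin l) ℕ}

/-- `E` is an admissible choice of `E_n(y)`: it consists of exactly one point from each (nonempty)
cylinder `[x_1 … x_n]` of `X_A` such that `π(x_1 … x_n) = y_1 … y_n`. -/
def IsFiberSelection (π : SFT A → SFT B) (n : ℕ) (y : SFT B) (E : Finset (SFT A)) : Prop :=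
  (∀ e ∈ E, π e ∈ cyl n y) ∧
  ∀ x : SFT A, π x ∈ cyl n y → ∃! e : SFT A, e ∈ E ∧ e ∈ cyl n x

/-- `g_n(y)`, the supremum of `∑_{x ∈ E_n(y)} e^{(S_n f)(x)}` over all choices of `E_n(y)`. -/
def relSeq (π : SFT A → SFT B) (f : SFT A → ℝ) (n : ℕ) (y : SFT B) : ℝ :=
  ⨆ E : {E : Finset (SFT A) // IsFiberSelection π n y E},
    ∑ x ∈ E.1, Real.exp (birkhoffSum (shift A) f n x)

end Relative

/-! ### Functions of two coordinates and the associated matrices -/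

section Matrices

variable {k : ℕ} {A : Matrix (Fin k) (Fin k) ℕ}

/-- `f` is a function of two coordinates. -/
def IsTwoCoordinate (f : SFT A → ℝ) : Prop :=
  ∀ x x' : SFT A, x.1 0 = x'.1 0 → x.1 1 = x'.1 1 → f x = f x'

open Classical in
/-- `f[ij]`, the value of `f` at any point of the cylinder `[ij]` (and `0` if `[ij]` is empty). -/
def pairValue (f : SFT A → ℝ) (i j : Fin k) : ℝ :=
  if h : ∃ x : SFT A, x.1 0 = i ∧ x.1 1 = j then f h.choose else 0

theorem pairValue_eq {f : SFT A → ℝ} (hf : IsTwoCoordinate f) (x : SFT A) :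
    pairValue f (x.1 0) (x.1 1) = f x := by
  have h : ∃ z : SFT A, z.1 0 = x.1 0 ∧ z.1 1 = x.1 1 := ⟨x, rfl, rfl⟩
  unfold pairValue
  rw [dif_pos h]
  exact hf _ _ h.choose_spec.1 h.choose_spec.2

open Classical in
/-- The matrix `M` with `M(i,j) = e^{f[ij]}` if `ij` is an allowable block, and `0` otherwise. -/
def pairMatrix (f : SFT A → ℝ) : Matrix (Fin k) (Fin k) ℝ :=
  Matrix.of fun i j => if [i, j] ∈ language (SFT A) then Real.exp (pairValue f i j) else 0

open Classical in
/-- The matrix `M_{b₁b₂}`, with entry `e^{f[ij]}` if `ij` is an allowable block that is mapped to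
`b₁b₂` by the symbol map `c`, and `0` otherwise. -/
def blockMatrix {l : ℕ} (c : Fin k → Fin l) (f : SFT A → ℝ) (b₁ b₂ : Fin l) :
    Matrix (Fin k) (Fin k) ℝ :=
  Matrix.of fun i j =>
    if [i, j] ∈ language (SFT A) ∧ c i = b₁ ∧ c j = b₂ then Real.exp (pairValue f i j) else 0

end Matrices

/-- The symbol map `1 ↦ 1`, `2 ↦ 2`, `3 ↦ 2` (the symbol `s` being written as `s - 1`). -/
def code : Fin 3 → Fin 2 := ![0, 1, 1]

/-- The `2 × 2` submatrix `M₂₂|_{π⁻¹(22)}` of `M₂₂` with rows and columns `2, 3`. -/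
def subM22 {A : Matrix (Fin 3) (Fin 3) ℕ} (f : SFT A → ℝ) : Matrix (Fin 2) (Fin 2) ℝ :=
  (blockMatrix code f 1 1).submatrix ![1, 2] ![1, 2]

end GibbsFactor

end

open GibbsFactor

/-!
The symbol `0` of `Y` has the single preimage `0` in `X`, so it is a renewal symbol of the factor
measure, and everything about `Y` is governed by the words `1 ⋯ 1` between two occurrences of `0`.

*The factor measure is a renewal measure.* The Gibbs measure `μ` of a function of two coordinates
is Markov (`exists_transition`): a limit of Cesàro means of row sums of powers of the normalized
matrix is a right eigenvector (`exists_right_eigenvector`), it defines a Markov chain with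
cylinder masses comparable to those of `μ`, and `eq_mul_of_entropy` identifies the conditional
probabilities of the two. Hence `μ.map π` forgets the past at each `0`
(`IsOneBlockFactorMap.wordMass_map_renewal`), and irreducibility makes the mass of `1 ⋯ 1` decay
exponentially (`IsOneBlockFactorMap.exists_decay`).

*The potential.* Up to bounded factors, `relSeq π f n` is the mass of cylinders of length `n`, scaled
by the pressure (`IsOneBlockFactorMap.relSeq_comparable`), so (weak) almost additivity is a property
of `ν = μ.map π`; it is immediate if `ν` is Gibbs for some function. Conversely, let `g y` be the
logarithm of the conditional probability of the first symbol of `y` given the following ones. By the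
renewal property it depends only on the first symbol and on the number `a` of symbols `1` between it
and the next `0`, through `gapRatio ν a = ν[1ᵃ⁺¹0] / ν[1ᵃ0]`. At the points without a
further `0` the missing conditional probability is replaced by the exponential rate of `ν[1ⁿ]`, which exists by additivity
(`exists_rate`). The Birkhoff sums of `g` telescope, and additivity turns the result into the (weak)
Gibbs inequality with pressure `0` (`IsRenewal.exists_gibbsBound`).

*Uniqueness.* Another weak Gibbs measure for `g` has vanishing relative entropy per symbol with
respect to `ν`. By `eq_mul_of_entropy` it has the same conditional probabilities after each word
containing `0`, and the decay of `ν[1ⁿ]` excludes mass at the fixed point `1 1 1 ⋯`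
(`IsRenewal.eq_of_weakGibbs`).

*Continuity.* The potential is continuous as soon as the gap ratios converge to a positive limit
(`IsRenewal.exists_potential`). By the Cayley–Hamilton theorem for the `2 × 2` matrix over the word
`1 1`, the masses `ν[1ᵃ0]` satisfy a recurrence of order two, whose ratios form an orbit of
`s ↦ T - D / s`. It converges if the trace `T` is positive (`exists_limit_of_moebius`); if `T = 0`,
the matrix is antidiagonal, and in the symmetric case the masses form a geometric sequence
(`IsOneBlockFactorMap.exists_limit_of_symmetric`).
-/

namespace GibbsFactor

/-! ### Sums over words -/

section WordSums

variable {α : Type*} [Fintype α]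

/-- The sum of `F w` over all words `w` of length `n`, built up by appending symbols. -/
def wordSum : ℕ → (List α → ℝ) → ℝ
  | 0, F => F []
  | n + 1, F => wordSum n fun w => ∑ a, F (w ++ [a])

theorem wordSum_mono {n : ℕ} {F G : List α → ℝ} (h : ∀ w, w.length = n → F w ≤ G w) :
    wordSum n F ≤ wordSum n G := by
  induction n generalizing F G with
  | zero => exact h [] rfl
  | succ n ih =>
    refine ih fun w hw => Finset.sum_le_sum fun a _ => h _ ?_
    simp [hw]

theorem wordSum_congr {n : ℕ} {F G : List α → ℝ} (h : ∀ w, w.length = n → F w = G w) :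
    wordSum n F = wordSum n G :=
  le_antisymm (wordSum_mono fun w hw => (h w hw).le) (wordSum_mono fun w hw => (h w hw).ge)

theorem wordSum_sum {ι : Type*} (s : Finset ι) (n : ℕ) (F : ι → List α → ℝ) :
    wordSum n (fun w => ∑ i ∈ s, F i w) = ∑ i ∈ s, wordSum n (F i) := by
  induction n generalizing F with
  | zero => rfl
  | succ n ih =>
    simp only [wordSum]
    rw [← ih]
    congr 1
    funext w
    rw [Finset.sum_comm]

theorem wordSum_mul_right (n : ℕ) (F : List α → ℝ) (c : ℝ) :
    wordSum n (fun w => F w * c) = wordSum n F * c := by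
  induction n generalizing F with
  | zero => rfl
  | succ n ih => simp only [wordSum, ← Finset.sum_mul, ih]

theorem wordSum_sub (n : ℕ) (F G : List α → ℝ) :
    wordSum n (fun w => F w - G w) = wordSum n F - wordSum n G := by
  induction n generalizing F G with
  | zero => rfl
  | succ n ih => simp only [wordSum, Finset.sum_sub_distrib, ih]

theorem wordSum_append_le {F : List α → ℝ} (hF : ∀ w, 0 ≤ F w) (j : ℕ) (s : List α) :
    wordSum j (fun w => F (w ++ s)) ≤ wordSum (j + s.length) F := by
  induction s using List.reverseRecOn generalizing F with
  | nil => simp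
  | append_singleton s a ih =>
    have h := ih (F := fun w => ∑ b, F (w ++ [b])) fun w => Finset.sum_nonneg fun b _ => hF _
    rw [List.length_append, List.length_singleton, ← add_assoc]
    refine le_trans (wordSum_mono fun w _ => ?_) h
    rw [← List.append_assoc]
    exact Finset.single_le_sum (f := fun b => F (w ++ s ++ [b])) (fun b _ => hF _)
      (Finset.mem_univ a)

theorem wordSum_right {p : List α → ℝ} (hp : ∀ w, ∑ a, p (w ++ [a]) = p w) (n : ℕ) (s : List α) :
    wordSum n (fun w => p (s ++ w)) = p s := by
  induction n with
  | zero => simp [wordSum]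
  | succ n ih =>
    simp only [wordSum]
    rw [← ih]
    refine wordSum_congr fun w _ => ?_
    simp only [← List.append_assoc, hp]

theorem wordSum_left {p : List α → ℝ} (hp : ∀ w, ∑ a, p (a :: w) = p w) (n : ℕ) (s : List α) :
    wordSum n (fun w => p (w ++ s)) = p s := by
  induction n generalizing s with
  | zero => simp [wordSum]
  | succ n ih =>
    simp only [wordSum, List.append_assoc, List.singleton_append]
    rw [wordSum_sum]
    simp only [ih, hp]

end WordSums

/-! ### Relative entropy -/

section Entropy

theorem sub_le_mul_log {x y : ℝ} (hx : 0 ≤ x) (hy : 0 ≤ y) (hxy : x ≠ 0 → y ≠ 0) :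
    x - y ≤ x * Real.log (x / y) := by
  rcases hx.eq_or_lt with rfl | hx
  · simpa using hy
  have hy' : 0 < y := lt_of_le_of_ne hy (hxy hx.ne').symm
  have h := Real.log_le_sub_one_of_pos (div_pos hy' hx)
  have h2 : Real.log (x / y) = - Real.log (y / x) := by
    rw [← Real.log_inv, inv_div]
  rw [h2]
  have h3 : x * (y / x) = y := by field_simp
  nlinarith

theorem eq_of_mul_log_le {x y : ℝ} (hx : 0 ≤ x) (hy : 0 ≤ y) (hxy : x ≠ 0 → y ≠ 0)
    (h : x * Real.log (x / y) ≤ x - y) : x = y := by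
  rcases hx.eq_or_lt with rfl | hx
  · have : y ≤ 0 := by simpa using h
    exact le_antisymm hy this
  have hy' : 0 < y := lt_of_le_of_ne hy (hxy hx.ne').symm
  by_contra hne
  have h1 := Real.log_lt_sub_one_of_pos (div_pos hy' hx) (by
    intro h1; rw [div_eq_one_iff_eq hx.ne'] at h1; exact hne h1.symm)
  have h2 : Real.log (x / y) = - Real.log (y / x) := by
    rw [← Real.log_inv, inv_div]
  rw [h2] at h
  have h3 : x * (y / x) = y := by field_simp
  nlinarith

variable {α : Type*} [Fintype α]

theorem sum_mul_log_nonneg {x y : α → ℝ} (hx : ∀ a, 0 ≤ x a) (hy : ∀ a, 0 ≤ y a)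
    (hxy : ∀ a, x a ≠ 0 → y a ≠ 0) (hs : ∑ a, x a = ∑ a, y a) :
    0 ≤ ∑ a, x a * Real.log (x a / y a) := by
  have := Finset.sum_le_sum fun a (_ : a ∈ Finset.univ) => sub_le_mul_log (hx a) (hy a) (hxy a)
  rw [Finset.sum_sub_distrib, hs, sub_self] at this
  exact this

theorem eq_of_sum_mul_log_nonpos {x y : α → ℝ} (hx : ∀ a, 0 ≤ x a) (hy : ∀ a, 0 ≤ y a)
    (hxy : ∀ a, x a ≠ 0 → y a ≠ 0) (hs : ∑ a, x a = ∑ a, y a)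
    (h : ∑ a, x a * Real.log (x a / y a) ≤ 0) (a : α) : x a = y a := by
  refine eq_of_mul_log_le (hx a) (hy a) (hxy a) ?_
  have h0 : ∑ a, (x a * Real.log (x a / y a) - (x a - y a)) ≤ 0 := by
    rw [Finset.sum_sub_distrib, Finset.sum_sub_distrib, hs]; linarith
  have h1 : ∀ a ∈ Finset.univ, 0 ≤ x a * Real.log (x a / y a) - (x a - y a) := fun a _ =>
    sub_nonneg.2 (sub_le_mul_log (hx a) (hy a) (hxy a))
  have := Finset.single_le_sum h1 (Finset.mem_univ a)
  linarith

/-- Vanishing of relative entropy per symbol forces equality of conditional probabilities. Here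
`p w` is the mass of the cylinder `[w]` for an invariant measure and `q` gives consistent reference
masses; `s` is a word after which the `q`-conditional distribution `t` of the next symbol does not
depend on what precedes `s`. The relative entropy of `p` with respect to `q` on words of length `n`
is at most `c n = o(n)`, while each of its increments is at least the relative entropy of
`p (s ++ [·])` with respect to `p s * t`. -/
theorem eq_mul_of_entropy {p q : List α → ℝ} (hp : ∀ w, 0 ≤ p w) (hq : ∀ w, 0 ≤ q w)
    (hpr : ∀ w, ∑ a, p (w ++ [a]) = p w) (hpl : ∀ w, ∑ a, p (a :: w) = p w)
    (hqr : ∀ w, ∑ a, q (w ++ [a]) = q w) {c : ℕ → ℝ}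
    (hc : Tendsto (fun n : ℕ => c n / n) atTop (𝓝 0))
    (hpq : ∀ w, p w ≤ Real.exp (c w.length) * q w) {s : List α} {t : α → ℝ}
    (hs : ∀ w a, q (w ++ s ++ [a]) = q (w ++ s) * t a) (a : α) :
    p (s ++ [a]) = p s * t a := by
  have hne : ∀ w, p w ≠ 0 → q w ≠ 0 := by
    intro w h h0
    have := hpq w
    rw [h0, mul_zero] at this
    exact h (le_antisymm this (hp w))
  have hr0 : ∀ w a, p w = 0 → p (w ++ [a]) = 0 := by
    intro w a h
    rw [← hpr] at h
    exact (Finset.sum_eq_zero_iff_of_nonneg fun a _ => hp _).1 h a (Finset.mem_univ a)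
  have hl0 : ∀ w v, p v = 0 → p (w ++ v) = 0 := by
    intro w v h
    induction w with
    | nil => exact h
    | cons b w ih =>
      rw [← hpl] at ih
      exact (Finset.sum_eq_zero_iff_of_nonneg fun a _ => hp _).1 ih b (Finset.mem_univ b)
  by_cases hps : p s = 0
  · rw [hr0 s a hps, hps, zero_mul]
  have hqs : 0 < q s := lt_of_le_of_ne (hq s) (hne s hps).symm
  have hs0 : ∀ a, q (s ++ [a]) = q s * t a := fun a => by simpa using hs [] a
  have ht : ∀ a, 0 ≤ t a := fun a => by
    have := hq (s ++ [a])
    rw [hs0] at this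
    exact nonneg_of_mul_nonneg_right this hqs
  have hts : ∑ a, t a = 1 := by
    have := hqr s
    simp only [hs0] at this
    rw [← Finset.mul_sum] at this
    exact mul_left_cancel₀ hqs.ne' (by rw [this, mul_one])
  set e : List α → ℝ := fun w => p w * Real.log (p w / q w) with he
  set d : List α → ℝ := fun w => ∑ a, e (w ++ [a]) - e w with hd
  have hd0 : ∀ w, 0 ≤ d w := by
    intro w
    by_cases hw : p w = 0
    · simp [hd, he, hw, hr0]
    have hqw := hne w hw
    have h := sum_mul_log_nonneg (x := fun a => p (w ++ [a]))
      (y := fun a => p w / q w * q (w ++ [a])) (fun a => hp _)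
      (fun a => mul_nonneg (div_nonneg (hp _) (hq _)) (hq _))
      (fun a h => mul_ne_zero (div_ne_zero hw hqw) (hne _ h))
      (by rw [← Finset.mul_sum, hpr, hqr]; field_simp)
    have h2 : d w = ∑ a, p (w ++ [a]) *
        Real.log (p (w ++ [a]) / (p w / q w * q (w ++ [a]))) := by
      simp only [hd, he]
      rw [← hpr w, Finset.sum_mul, ← Finset.sum_sub_distrib, hpr w]
      refine Finset.sum_congr rfl fun a _ => ?_
      by_cases hx : p (w ++ [a]) = 0
      · simp [hx]
      have hy := hne _ hx
      rw [← mul_sub, ← Real.log_div (div_ne_zero hx hy) (div_ne_zero hw hqw)]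
      congr 2
      field_simp
    rw [h2]; exact h
  set K : ℝ := ∑ a, p (s ++ [a]) * Real.log (p (s ++ [a]) / (p s * t a)) with hK
  -- Comparing `p (w ++ s ++ [·])` with `p (w ++ s) * p (s ++ [·]) / p s` bounds the increment at
  -- `w ++ s` below by an expression that is linear in `p`.
  have hds : ∀ w, ∑ a, p (w ++ (s ++ [a])) * Real.log (p (s ++ [a]) / (p s * t a))
      ≤ d (w ++ s) := by
    intro w
    simp only [← List.append_assoc]
    by_cases hw : p (w ++ s) = 0
    · simp [-List.append_assoc, hd, he, hw, hr0]
    have hqw := hne _ hw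
    have hsa : ∀ a, p (w ++ s ++ [a]) ≠ 0 → p (s ++ [a]) ≠ 0 := fun a h h0 => h (by
      rw [List.append_assoc]; exact hl0 _ _ h0)
    have h := sum_mul_log_nonneg (x := fun a => p (w ++ s ++ [a]))
      (y := fun a => p (w ++ s) / p s * p (s ++ [a])) (fun a => hp _)
      (fun a => mul_nonneg (div_nonneg (hp _) (hp _)) (hp _))
      (fun a h => mul_ne_zero (div_ne_zero hw hps) (hsa a h))
      (by rw [← Finset.mul_sum, hpr, hpr]; field_simp)
    have h2 : d (w ++ s) -
        ∑ a, p (w ++ s ++ [a]) * Real.log (p (s ++ [a]) / (p s * t a))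
        = ∑ a, p (w ++ s ++ [a]) *
          Real.log (p (w ++ s ++ [a]) / (p (w ++ s) / p s * p (s ++ [a]))) := by
      simp only [hd, he]
      rw [← hpr (w ++ s), Finset.sum_mul, ← Finset.sum_sub_distrib, ← Finset.sum_sub_distrib,
        hpr (w ++ s)]
      refine Finset.sum_congr rfl fun a _ => ?_
      by_cases hx : p (w ++ s ++ [a]) = 0
      · simp [-List.append_assoc, hx]
      have hy := hne _ hx
      have hy2 := hsa a hx
      have hta : t a ≠ 0 := by
        intro h0
        rw [hs, h0, mul_zero] at hy
        exact hy rfl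
      rw [← mul_sub, ← mul_sub, ← Real.log_div (div_ne_zero hx hy) (div_ne_zero hw hqw),
        ← Real.log_div _ (div_ne_zero hy2 (mul_ne_zero hps hta))]
      · congr 2
        rw [hs]
        field_simp
      · exact div_ne_zero (div_ne_zero hx hy) (div_ne_zero hw hqw)
    rw [← h2] at h
    linarith
  have hKd : ∀ j, K ≤ wordSum (j + s.length) d := by
    intro j
    refine le_trans (le_of_eq ?_) ((wordSum_mono fun w _ => hds w).trans
      (wordSum_append_le hd0 j s))
    rw [wordSum_sum]
    refine Finset.sum_congr rfl fun a _ => ?_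
    rw [wordSum_mul_right, wordSum_left hpl]
  have hD : ∀ j : ℕ, wordSum s.length e + j * K ≤ wordSum (j + s.length) e := by
    intro j
    induction j with
    | zero => simp
    | succ j ih =>
      have h1 := hKd j
      rw [hd, wordSum_sub] at h1
      have h2 : wordSum (j + 1 + s.length) e
          = wordSum (j + s.length) (fun w => ∑ a, e (w ++ [a])) := by
        rw [add_right_comm]; rfl
      push_cast
      linarith
  have hup : ∀ n, wordSum n e ≤ p [] * c n := by
    intro n
    have h1 : wordSum n (fun w => p w * c n) = p [] * c n := by
      rw [wordSum_mul_right]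
      congr 1
      simpa using wordSum_right hpr n []
    rw [← h1]
    refine wordSum_mono fun w hw => ?_
    by_cases h0 : p w = 0
    · simp [he, h0]
    have hpw : 0 < p w := lt_of_le_of_ne (hp w) (Ne.symm h0)
    have hqw : 0 < q w := lt_of_le_of_ne (hq w) (hne w h0).symm
    refine mul_le_mul_of_nonneg_left ?_ hpw.le
    rw [Real.log_le_iff_le_exp (div_pos hpw hqw), div_le_iff₀ hqw, ← hw]
    exact hpq w
  have hK0 : K ≤ 0 := by
    have hlim : Tendsto (fun j : ℕ => p [] * (c (j + s.length) / ((j + s.length : ℕ) : ℝ))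
        - (wordSum s.length e - s.length * K) / ((j + s.length : ℕ) : ℝ)) atTop (𝓝 0) := by
      have h1 := (hc.comp (tendsto_add_atTop_nat s.length)).const_mul (p [])
      have h2 := (tendsto_const_div_atTop_nhds_zero_nat
        (wordSum s.length e - s.length * K)).comp (tendsto_add_atTop_nat s.length)
      simpa using h1.sub h2
    refine ge_of_tendsto hlim ?_
    filter_upwards [eventually_gt_atTop 0] with j hj
    have hj' : (0 : ℝ) < ((j + s.length : ℕ) : ℝ) := by positivity
    have h1 := hD j
    have h2 := hup (j + s.length)
    rw [← mul_div_assoc, ← sub_div, le_div_iff₀ hj']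
    push_cast
    linarith
  refine eq_of_sum_mul_log_nonpos (x := fun a => p (s ++ [a])) (y := fun a => p s * t a)
    (fun a => hp _) (fun a => mul_nonneg (hp _) (ht a)) (fun a h => ?_) ?_ hK0 a
  · refine mul_ne_zero hps fun h0 => hne _ h ?_
    rw [hs0, h0, mul_zero]
  · rw [hpr, ← Finset.mul_sum, hts, mul_one]

end Entropy

/-! ### Cylinders of words -/

section Cylinders

variable {k : ℕ} {A : Matrix (Fin k) (Fin k) ℕ}

/-- The word formed by the first `n` symbols of `x`. -/
def initWord : ℕ → SFT A → List (Fin k)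
  | 0, _ => []
  | n + 1, x => x.1 0 :: initWord n (shift A x)

/-- The cylinder of the word `w`; it is empty if `w` is not allowable. -/
def wordCyl (A : Matrix (Fin k) (Fin k) ℕ) (w : List (Fin k)) : Set (SFT A) :=
  {x | initWord w.length x = w}

/-- The mass of the cylinder of the word `w`. -/
noncomputable def wordMass (ν : Measure (SFT A)) (w : List (Fin k)) : ℝ := ν.real (wordCyl A w)

theorem shift_iterate_apply (n : ℕ) (x : SFT A) (i : ℕ) :
    ((shift A)^[n] x).1 i = x.1 (n + i) := by
  induction n generalizing x with
  | zero => simp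
  | succ n ih =>
    rw [Function.iterate_succ_apply, ih]
    change x.1 (n + i + 1) = _
    rw [show n + i + 1 = n + 1 + i by omega]

@[simp] theorem length_initWord (n : ℕ) (x : SFT A) : (initWord n x).length = n := by
  induction n generalizing x with
  | zero => rfl
  | succ n ih => simp [initWord, ih]

theorem initWord_add (n m : ℕ) (x : SFT A) :
    initWord (n + m) x = initWord n x ++ initWord m ((shift A)^[n] x) := by
  induction n generalizing x with
  | zero => simp [initWord]
  | succ n ih => rw [add_right_comm]; simp [initWord, ih]

theorem initWord_succ_right (n : ℕ) (x : SFT A) :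
    initWord (n + 1) x = initWord n x ++ [x.1 n] := by
  rw [initWord_add]
  simp [initWord, shift_iterate_apply]

@[simp] theorem wordCyl_nil : wordCyl A [] = Set.univ := by
  ext; simp [wordCyl, initWord]

theorem mem_wordCyl_cons {a : Fin k} {w : List (Fin k)} {x : SFT A} :
    x ∈ wordCyl A (a :: w) ↔ x.1 0 = a ∧ shift A x ∈ wordCyl A w := by
  simp [wordCyl, initWord]

theorem mem_wordCyl_append {u v : List (Fin k)} {x : SFT A} :
    x ∈ wordCyl A (u ++ v) ↔ x ∈ wordCyl A u ∧ (shift A)^[u.length] x ∈ wordCyl A v := by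
  induction u generalizing x with
  | nil => simp
  | cons a u ih => simp [mem_wordCyl_cons, ih, and_assoc]

theorem mem_wordCyl_append_singleton {u : List (Fin k)} {a : Fin k} {x : SFT A} :
    x ∈ wordCyl A (u ++ [a]) ↔ x ∈ wordCyl A u ∧ x.1 u.length = a := by
  simp [mem_wordCyl_append, mem_wordCyl_cons, shift_iterate_apply]

theorem mem_wordCyl_initWord (n : ℕ) (x : SFT A) : x ∈ wordCyl A (initWord n x) := by
  simp [wordCyl]

theorem initWord_eq_of_mem {w : List (Fin k)} {x : SFT A} (h : x ∈ wordCyl A w) :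
    initWord w.length x = w := h

theorem initWord_eq_iff {n : ℕ} {x z : SFT A} :
    initWord n z = initWord n x ↔ z ∈ cyl n x := by
  induction n generalizing x z with
  | zero => simp [initWord, cyl]
  | succ n ih =>
    simp only [initWord, List.cons.injEq, ih, cyl, Set.mem_ofPred_eq, shift]
    constructor
    · rintro ⟨h0, h⟩ i hi
      cases i with
      | zero => exact h0
      | succ i => exact h i (by omega)
    · intro h
      exact ⟨h 0 (by omega), fun i hi => h (i + 1) (by omega)⟩

theorem cyl_eq_wordCyl (n : ℕ) (x : SFT A) : cyl n x = wordCyl A (initWord n x) := by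
  ext z
  rw [← initWord_eq_iff]
  simp [wordCyl]

theorem wordCyl_nonempty_of_mem_language {w : List (Fin k)} (h : w ∈ language (SFT A)) :
    (wordCyl A w).Nonempty := by
  obtain ⟨x, hx, m, hm⟩ := h
  refine ⟨(shift A)^[m] ⟨x, hx⟩, ?_⟩
  refine List.ext_getElem (by simp) fun i h1 h2 => ?_
  rw [← hm i h2]
  have key : ∀ (n i : ℕ) (z : SFT A) (h : i < (initWord n z).length),
      (initWord n z)[i] = z.1 i := by
    intro n
    induction n with
    | zero => intro i z h; simp at h
    | succ n ih =>
      intro i z h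
      cases i with
      | zero => rfl
      | succ i => exact ih i (shift A z) (by simpa [initWord] using h)
  rw [key, shift_iterate_apply]

theorem mem_language_pair (x : SFT A) (n : ℕ) : [x.1 n, x.1 (n + 1)] ∈ language (SFT A) :=
  ⟨x.1, x.2, n, fun i h => by
    match i, h with
    | 0, _ => rfl
    | 1, _ => rfl⟩

theorem measurable_coord (n : ℕ) : Measurable fun x : SFT A => x.1 n :=
  (measurable_pi_apply n).comp measurable_subtype_coe

theorem measurable_shift : Measurable (shift A) :=
  Measurable.subtype_mk (measurable_pi_lambda _ fun n => measurable_coord (n + 1))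

theorem measurableSet_wordCyl (w : List (Fin k)) : MeasurableSet (wordCyl A w) := by
  induction w with
  | nil => simp
  | cons a w ih =>
    have : wordCyl A (a :: w)
        = (fun x : SFT A => x.1 0) ⁻¹' {a} ∩ shift A ⁻¹' wordCyl A w := by
      ext x; exact mem_wordCyl_cons
    rw [this]
    exact (measurable_coord 0 (measurableSet_singleton a)).inter (measurable_shift ih)

/-- Splitting a measurable set according to the symbol at position `n`. -/
theorem sum_measureReal_coord (ν : Measure (SFT A)) [IsFiniteMeasure ν] (n : ℕ)
    {Z : Set (SFT A)} (hZ : MeasurableSet Z) :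
    ∑ a, ν.real {x | x ∈ Z ∧ x.1 n = a} = ν.real Z := by
  rw [← measureReal_biUnion_finset]
  · congr 1
    ext x; simp
  · intro a _ b _ hab
    refine Set.disjoint_left.2 fun x hx hx' => hab ?_
    rw [← hx.2, ← hx'.2]
  · intro a _
    exact hZ.inter (measurable_coord n (measurableSet_singleton a))

theorem wordMass_nonneg (ν : Measure (SFT A)) (w : List (Fin k)) : 0 ≤ wordMass ν w :=
  measureReal_nonneg

variable {ν : Measure (SFT A)}

theorem wordMass_nil (hν : IsInvariantProb ν) : wordMass ν [] = 1 := by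
  have := hν.1
  simp [wordMass]

theorem sum_wordMass_append (hν : IsInvariantProb ν) (w : List (Fin k)) :
    ∑ a, wordMass ν (w ++ [a]) = wordMass ν w := by
  have := hν.1
  rw [wordMass, ← sum_measureReal_coord ν w.length (measurableSet_wordCyl w)]
  refine Finset.sum_congr rfl fun a _ => ?_
  rw [wordMass]
  congr 1
  ext x; exact mem_wordCyl_append_singleton

theorem sum_wordMass_cons (hν : IsInvariantProb ν) (w : List (Fin k)) :
    ∑ a, wordMass ν (a :: w) = wordMass ν w := by
  have := hν.1
  rw [wordMass, ← hν.2.measureReal_preimage (measurableSet_wordCyl w).nullMeasurableSet,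
    ← sum_measureReal_coord ν 0 (measurable_shift (measurableSet_wordCyl w))]
  refine Finset.sum_congr rfl fun a _ => ?_
  rw [wordMass]
  congr 1
  ext x; rw [mem_wordCyl_cons, and_comm]; rfl

theorem wordMass_append_le (hν : IsInvariantProb ν) (w v : List (Fin k)) :
    wordMass ν (w ++ v) ≤ wordMass ν w := by
  have := hν.1
  exact measureReal_mono fun x hx => (mem_wordCyl_append.1 hx).1

theorem wordMass_eq_zero {w : List (Fin k)} (h : ¬ (wordCyl A w).Nonempty) :
    wordMass ν w = 0 := by
  rw [wordMass, Set.not_nonempty_iff_eq_empty.1 h, measureReal_empty]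

theorem eq_of_wordMass_eq {ν ν' : Measure (SFT A)} (hν : IsInvariantProb ν)
    (hν' : IsInvariantProb ν') (h : ∀ w, wordMass ν w = wordMass ν' w) : ν = ν' := by
  have := hν.1
  have := hν'.1
  refine ext_of_generate_finite (Set.range (wordCyl A)) ?_ ?_ ?_ ?_
  · refine le_antisymm ?_ (MeasurableSpace.generateFrom_le ?_)
    · have hle : (Subtype.instMeasurableSpace : MeasurableSpace (SFT A))
          = ⨆ n, MeasurableSpace.comap (fun x : SFT A => x.1 n) ⊤ := by
        change MeasurableSpace.comap Subtype.val (MeasurableSpace.pi) = _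
        rw [MeasurableSpace.pi, MeasurableSpace.comap_iSup]
        simp only [MeasurableSpace.comap_comp]
        rfl
      rw [hle]
      refine iSup_le fun n => ?_
      rintro _ ⟨S, -, rfl⟩
      have : (fun x : SFT A => x.1 n) ⁻¹' S
          = ⋃ w ∈ {w : List (Fin k) | w.length = n}, ⋃ a ∈ S, wordCyl A (w ++ [a]) := by
        ext x
        simp only [Set.mem_preimage, Set.mem_iUnion, mem_wordCyl_append_singleton, exists_prop]
        constructor
        · intro hx
          exact ⟨initWord n x, length_initWord n x, x.1 n, hx, mem_wordCyl_initWord n x, by simp⟩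
        · rintro ⟨w, hw, a, ha, -, h⟩
          rw [Set.mem_ofPred_eq] at hw
          rw [← hw, h]; exact ha
      rw [this]
      refine MeasurableSet.biUnion (Set.to_countable _) fun w _ =>
        MeasurableSet.biUnion (Set.to_countable _) fun a _ =>
          MeasurableSpace.measurableSet_generateFrom ⟨_, rfl⟩
    · rintro _ ⟨w, rfl⟩
      exact measurableSet_wordCyl w
  · rintro _ ⟨u, rfl⟩ _ ⟨v, rfl⟩ ⟨x, hxu, hxv⟩
    have key : ∀ u v : List (Fin k), x ∈ wordCyl A u → x ∈ wordCyl A v → u.length ≤ v.length →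
        wordCyl A u ∩ wordCyl A v = wordCyl A v := by
      intro u v hu hv huv
      obtain ⟨m, hm⟩ := Nat.exists_eq_add_of_le huv
      have : v = u ++ initWord m ((shift A)^[u.length] x) := by
        rw [← initWord_eq_of_mem hv, hm, initWord_add, initWord_eq_of_mem hu]
      rw [this]
      exact Set.inter_eq_right.2 fun z hz => (mem_wordCyl_append.1 hz).1
    rcases le_total u.length v.length with h | h
    · exact ⟨v, (key u v hxu hxv h).symm⟩
    · exact ⟨u, by rw [Set.inter_comm]; exact (key v u hxv hxu h).symm⟩
  · rintro _ ⟨w, rfl⟩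
    have := h w
    rwa [wordMass, wordMass, measureReal_eq_measureReal_iff] at this
  · simp

theorem GibbsBound.wordMass_le {g : SFT A → ℝ} {P C : ℝ} {n : ℕ} {x : SFT A}
    (h : GibbsBound ν g P C n x) :
    wordMass ν (initWord n x) ≤ C * Real.exp (-(n * P) + birkhoffSum (shift A) g n x) := by
  have h2 := h.2
  rw [← Real.exp_add, div_le_iff₀ (Real.exp_pos _), cyl_eq_wordCyl] at h2
  exact h2

theorem GibbsBound.le_wordMass {g : SFT A → ℝ} {P C : ℝ} {n : ℕ} {x : SFT A} (hC : 0 < C)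
    (h : GibbsBound ν g P C n x) :
    Real.exp (-(n * P) + birkhoffSum (shift A) g n x) ≤ C * wordMass ν (initWord n x) := by
  have h1 := h.1
  rw [← Real.exp_add, le_div_iff₀ (Real.exp_pos _), cyl_eq_wordCyl, one_div,
    inv_mul_le_iff₀ hC] at h1
  exact h1

theorem gibbsBound_of_le {g : SFT A → ℝ} {P C : ℝ} {n : ℕ} {x : SFT A} (hC : 0 < C)
    (h1 : wordMass ν (initWord n x) ≤ C * Real.exp (-(n * P) + birkhoffSum (shift A) g n x))
    (h2 : Real.exp (-(n * P) + birkhoffSum (shift A) g n x) ≤ C * wordMass ν (initWord n x)) :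
    GibbsBound ν g P C n x := by
  rw [GibbsBound, ← Real.exp_add, le_div_iff₀ (Real.exp_pos _), div_le_iff₀ (Real.exp_pos _),
    cyl_eq_wordCyl, one_div, inv_mul_le_iff₀ hC]
  exact ⟨h2, h1⟩

theorem IsInvariantGibbs.weak {g : SFT A → ℝ} (h : IsInvariantGibbs ν g) :
    IsInvariantWeakGibbs ν g := by
  obtain ⟨h0, P, C, hC, hb⟩ := h
  refine ⟨h0, P, fun _ => C, fun _ _ => hC, ?_, fun x n hn => hb x n hn⟩
  have := tendsto_const_div_atTop_nhds_zero_nat (Real.log C)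
  refine this.congr fun n => by ring

theorem IsInvariantWeakGibbs.wordMass_pos {g : SFT A → ℝ} (h : IsInvariantWeakGibbs ν g)
    {w : List (Fin k)} (hw : (wordCyl A w).Nonempty) : 0 < wordMass ν w := by
  obtain ⟨h0, P, C, hC, -, hb⟩ := h
  rcases w.eq_nil_or_concat with rfl | ⟨w', a, rfl⟩
  · rw [wordMass_nil h0]; exact one_pos
  · obtain ⟨x, hx⟩ := hw
    have hl : 1 ≤ (w' ++ [a]).length := by simp
    rw [List.concat_eq_append] at hx ⊢
    have := (hb x _ hl).le_wordMass (hC _ hl)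
    rw [initWord_eq_of_mem hx] at this
    exact pos_of_mul_pos_right ((Real.exp_pos _).trans_le this) (hC _ hl).le

end Cylinders

/-! ### Gibbs measures for two-coordinate functions are Markov -/

section Markov

theorem wordSum_succ_left {α : Type*} [Fintype α] (n : ℕ) (F : List α → ℝ) :
    wordSum (n + 1) F = ∑ a, wordSum n fun w => F (a :: w) := by
  induction n generalizing F with
  | zero => rfl
  | succ n ih => rw [wordSum, ih]; rfl

/-- The weight `Q a w₁ * Q w₁ w₂ * ⋯ * v (wₙ)` of the path `a w`, with terminal weights `v`. -/
def pathWeight {α : Type*} (Q : Matrix α α ℝ) (v : α → ℝ) : α → List α → ℝ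
  | a, [] => v a
  | a, b :: w => Q a b * pathWeight Q v b w

section

variable {α : Type*} {Q : Matrix α α ℝ} {v : α → ℝ}

theorem pathWeight_nonneg (hQ : ∀ a b, 0 ≤ Q a b) (hv : ∀ a, 0 ≤ v a) (a : α) (w : List α) :
    0 ≤ pathWeight Q v a w := by
  induction w generalizing a with
  | nil => exact hv a
  | cons b w ih => exact mul_nonneg (hQ _ _) (ih b)

theorem sum_pathWeight_append [Fintype α] (hv : ∀ a, ∑ b, Q a b * v b = v a) (a : α) (w : List α) :
    ∑ b, pathWeight Q v a (w ++ [b]) = pathWeight Q v a w := by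
  induction w generalizing a with
  | nil => exact hv a
  | cons b w ih => simp only [List.cons_append, pathWeight, ← Finset.mul_sum, ih]

theorem pathWeight_append {t : α → α → ℝ} (ht : ∀ a b, Q a b * v b = v a * t a b)
    (a b c : α) (w : List α) :
    pathWeight Q v a (w ++ [b] ++ [c]) = pathWeight Q v a (w ++ [b]) * t b c := by
  induction w generalizing a with
  | nil => simp [pathWeight, ht b c, mul_assoc]
  | cons d w ih =>
    have := ih d
    simp only [List.append_assoc, List.cons_append, List.nil_append, pathWeight] at this ⊢
    rw [this, mul_assoc]

end

variable {k : ℕ} {A : Matrix (Fin k) (Fin k) ℕ} {f : SFT A → ℝ}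

theorem pairMatrix_nonneg (f : SFT A → ℝ) (i j : Fin k) : 0 ≤ pairMatrix f i j := by
  simp only [pairMatrix, Matrix.of_apply]
  split_ifs
  · exact (Real.exp_pos _).le
  · exact le_rfl

theorem pairMatrix_apply_point (hf : IsTwoCoordinate f) (x : SFT A) :
    pairMatrix f (x.1 0) (x.1 1) = Real.exp (f x) := by
  simp only [pairMatrix, Matrix.of_apply]
  rw [if_pos (mem_language_pair x 0), pairValue_eq hf]

theorem mem_language_of_pairMatrix_ne_zero {i j : Fin k} (h : pairMatrix f i j ≠ 0) :
    [i, j] ∈ language (SFT A) := by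
  by_contra h0
  exact h (by simp [pairMatrix, h0])

theorem wordCyl_pair_nonempty {i j : Fin k} (h : pairMatrix f i j ≠ 0) :
    (wordCyl A [i, j]).Nonempty :=
  wordCyl_nonempty_of_mem_language (mem_language_of_pairMatrix_ne_zero h)

theorem wordCyl_cons_cons_nonempty {i j : Fin k} {w : List (Fin k)} (h : pairMatrix f i j ≠ 0)
    (hw : (wordCyl A (j :: w)).Nonempty) : (wordCyl A (i :: j :: w)).Nonempty := by
  obtain ⟨z, hz⟩ := wordCyl_pair_nonempty h
  obtain ⟨x, hx⟩ := hw
  have hz0 : z.1 0 = i := (mem_wordCyl_cons.1 hz).1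
  have hz1 : z.1 1 = j := (mem_wordCyl_cons.1 (mem_wordCyl_cons.1 hz).2).1
  have hx0 : x.1 0 = j := (mem_wordCyl_cons.1 hx).1
  have hij : A i j = 1 := by rw [← hz0, ← hz1]; exact z.2 0
  have hy : (fun n => Nat.casesOn n i x.1 : ℕ → Fin k) ∈ SFT A := by
    intro n
    cases n with
    | zero => change A i (x.1 0) = 1; rw [hx0, hij]
    | succ n => exact x.2 n
  exact ⟨⟨_, hy⟩, mem_wordCyl_cons.2 ⟨rfl, hx⟩⟩

theorem wordCyl_nonempty_of_pathWeight_ne_zero {c : ℝ} {v : Fin k → ℝ} {i j : Fin k}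
    {w : List (Fin k)} (h : pathWeight (c • pairMatrix f) v i (j :: w) ≠ 0) :
    (wordCyl A (i :: j :: w)).Nonempty := by
  induction w generalizing i j with
  | nil =>
    refine wordCyl_pair_nonempty (f := f) fun h0 => h ?_
    simp [pathWeight, h0]
  | cons l w ih =>
    refine wordCyl_cons_cons_nonempty (f := f) (fun h0 => h ?_) (ih fun h0 => h ?_)
    · simp [pathWeight, h0]
    · rw [pathWeight, h0, mul_zero]

theorem pathWeight_point (hf : IsTwoCoordinate f) (P : ℝ) (v : Fin k → ℝ) (n : ℕ) (x : SFT A) :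
    pathWeight (Real.exp (-P) • pairMatrix f) v (x.1 0) (initWord n (shift A x))
      = Real.exp (-(n * P) + birkhoffSum (shift A) f n x) * v (x.1 n) := by
  induction n generalizing x with
  | zero => simp [initWord, pathWeight]
  | succ n ih =>
    have h1 := ih (shift A x)
    have h2 : (shift A x).1 0 = x.1 1 := rfl
    rw [initWord, pathWeight, h1, Matrix.smul_apply, h2, pairMatrix_apply_point hf,
      birkhoffSum_succ', smul_eq_mul, ← mul_assoc, ← Real.exp_add, ← Real.exp_add]
    congr 2
    push_cast; ring

theorem IsTwoCoordinate.bounded (hf : IsTwoCoordinate f) : ∃ F, ∀ x, |f x| ≤ F := by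
  refine ⟨∑ i, ∑ j, |pairValue f i j|, fun x => ?_⟩
  rw [← pairValue_eq hf]
  exact (Finset.single_le_sum (f := fun j => |pairValue f (x.1 0) j|)
    (fun _ _ => abs_nonneg _) (Finset.mem_univ (x.1 1))).trans
    (Finset.single_le_sum (f := fun i => ∑ j, |pairValue f i j|)
      (fun _ _ => Finset.sum_nonneg fun _ _ => abs_nonneg _) (Finset.mem_univ (x.1 0)))

variable {μ : Measure (SFT A)}

/-- The Gibbs inequality with the Birkhoff sum one step shorter than the cylinder, so that both
are functions of the word alone. -/
theorem exists_gibbs_succ (hf : IsTwoCoordinate f) {P C : ℝ} (hC : 0 < C)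
    (hb : ∀ (x : SFT A) (n : ℕ), 1 ≤ n → GibbsBound μ f P C n x) :
    ∃ K, 0 < K ∧ ∀ (x : SFT A) (n : ℕ),
      wordMass μ (initWord (n + 1) x) ≤ K * Real.exp (-(n * P) + birkhoffSum (shift A) f n x) ∧
      Real.exp (-(n * P) + birkhoffSum (shift A) f n x) ≤ K * wordMass μ (initWord (n + 1) x) := by
  obtain ⟨F, hF⟩ := hf.bounded
  refine ⟨C * Real.exp (|P| + F), by positivity, fun x n => ?_⟩
  have h := hb x (n + 1) (by omega)
  have h1 := h.wordMass_le
  have h2 := h.le_wordMass hC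
  rw [birkhoffSum_succ] at h1 h2
  have hFx := abs_le.1 (hF ((shift A)^[n] x))
  have hP := abs_le.1 (le_refl |P|)
  constructor
  · refine h1.trans ?_
    rw [mul_assoc, ← Real.exp_add]
    refine mul_le_mul_of_nonneg_left (Real.exp_le_exp.2 ?_) hC.le
    push_cast; linarith
  · have h3 := mul_le_mul_of_nonneg_left h2 (Real.exp_pos (|P| + F)).le
    rw [← Real.exp_add] at h3
    calc _ ≤ _ := Real.exp_le_exp.2 (by push_cast; linarith)
      _ ≤ _ := h3
      _ = _ := by ring

/-- A right Perron eigenvector of the normalized matrix, positive on the allowable symbols: a limit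
of Cesàro means of the row sums of its powers, which the Gibbs inequality bounds above and below. -/
theorem exists_right_eigenvector (hf : IsTwoCoordinate f) (hμ : IsInvariantProb μ) {P C : ℝ}
    (hC : 0 < C) (hb : ∀ (x : SFT A) (n : ℕ), 1 ≤ n → GibbsBound μ f P C n x) :
    ∃ r : Fin k → ℝ, (∀ i, 0 ≤ r i) ∧
      (∀ i, ∑ j, (Real.exp (-P) • pairMatrix f) i j * r j = r i) ∧
      ∃ K, 0 < K ∧ ∀ x : SFT A, 1 ≤ K * r (x.1 0) := by
  obtain ⟨K, hK, hKb⟩ := exists_gibbs_succ hf hC hb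
  set Q := Real.exp (-P) • pairMatrix f with hQ
  have hQ0 : ∀ i j, 0 ≤ Q i j := fun i j => by
    rw [hQ, Matrix.smul_apply, smul_eq_mul]
    exact mul_nonneg (Real.exp_pos _).le (pairMatrix_nonneg f i j)
  set v : ℕ → Fin k → ℝ := fun n i => wordSum (n + 1) (pathWeight Q (fun _ => 1) i) with hv
  have hsum : ∀ n i, wordSum n (fun w => wordMass μ (i :: w)) = wordMass μ [i] := fun n i =>
    wordSum_right (sum_wordMass_append hμ) n [i]
  have hstep : ∀ n i, v (n + 1) i = ∑ j, Q i j * v n j := by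
    intro n i
    simp only [hv]
    rw [wordSum_succ_left]
    refine Finset.sum_congr rfl fun j _ => ?_
    simp only [pathWeight, mul_comm (Q i j)]
    rw [wordSum_mul_right]
  have hword : ∀ (i : Fin k) (w : List (Fin k)) (x : SFT A), x ∈ wordCyl A (i :: w) →
      pathWeight Q (fun _ => 1) i w
        = Real.exp (-(w.length * P) + birkhoffSum (shift A) f w.length x) ∧
      initWord (w.length + 1) x = i :: w := by
    intro i w x hx
    have h1 := pathWeight_point hf P (fun _ => 1) w.length x
    have h2 := mem_wordCyl_cons.1 hx
    rw [initWord_eq_of_mem h2.2, h2.1, mul_one] at h1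
    exact ⟨h1, initWord_eq_of_mem hx⟩
  have hup : ∀ n i, v n i ≤ K := by
    intro n i
    have h1 : v n i ≤ wordSum (n + 1) (fun w => wordMass μ (i :: w) * K) := by
      refine wordSum_mono fun w hw => ?_
      obtain ⟨j, w', rfl⟩ : ∃ j w', w = j :: w' := by
        cases w with
        | nil => simp at hw
        | cons j w' => exact ⟨j, w', rfl⟩
      by_cases h0 : pathWeight Q (fun _ => 1) i (j :: w') = 0
      · rw [h0]; exact mul_nonneg (wordMass_nonneg _ _) hK.le
      · obtain ⟨x, hx⟩ := wordCyl_nonempty_of_pathWeight_ne_zero h0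
        obtain ⟨h1, h2⟩ := hword _ _ _ hx
        rw [h1, mul_comm _ K, ← h2]
        exact (hKb x _).2
    rw [wordSum_mul_right, hsum] at h1
    have h2 : wordMass μ [i] ≤ 1 := by
      rw [← wordMass_nil hμ]; exact wordMass_append_le hμ [] [i]
    nlinarith
  have hlow : ∀ n i, wordMass μ [i] ≤ K * v n i := by
    intro n i
    rw [← hsum (n + 1) i, mul_comm, hv, ← wordSum_mul_right]
    refine wordSum_mono fun w _ => ?_
    by_cases h0 : (wordCyl A (i :: w)).Nonempty
    · obtain ⟨x, hx⟩ := h0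
      obtain ⟨h1, h2⟩ := hword _ _ _ hx
      rw [h1, mul_comm _ K, ← h2]
      exact (hKb x _).1
    · rw [wordMass_eq_zero h0]
      exact mul_nonneg (pathWeight_nonneg hQ0 (fun _ => zero_le_one) _ _) hK.le
  have hv0 : ∀ n i, 0 ≤ v n i := fun n i =>
    nonneg_of_mul_nonneg_right ((wordMass_nonneg _ _).trans (hlow n i)) hK
  set u : ℕ → Fin k → ℝ := fun n i => (∑ m ∈ Finset.range (n + 1), v m i) / (n + 1 : ℝ) with hu
  have hn1 : ∀ n : ℕ, (0 : ℝ) < n + 1 := fun n => by positivity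
  have hu0 : ∀ n i, 0 ≤ u n i := fun n i =>
    div_nonneg (Finset.sum_nonneg fun m _ => hv0 m i) (hn1 n).le
  have huK : ∀ n i, u n i ≤ K := by
    intro n i
    simp only [hu]
    rw [div_le_iff₀ (hn1 n)]
    refine (Finset.sum_le_card_nsmul _ _ K fun m _ => hup m i).trans (le_of_eq ?_)
    simp; ring
  have hulow : ∀ n i, wordMass μ [i] ≤ K * u n i := by
    intro n i
    simp only [hu]
    rw [← mul_div_assoc, le_div_iff₀ (hn1 n), Finset.mul_sum]
    refine le_trans (le_of_eq ?_)
      (Finset.card_nsmul_le_sum _ _ (wordMass μ [i]) fun m _ => hlow m i)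
    simp; ring
  obtain ⟨r, hr, φ, hφ, hlim⟩ := (isCompact_Icc (a := (0 : Fin k → ℝ)) (b := fun _ => K)).tendsto_subseq
    (x := u) fun n => ⟨fun i => hu0 n i, fun i => huK n i⟩
  rw [tendsto_pi_nhds] at hlim
  refine ⟨r, fun i => hr.1 i, fun i => ?_, K * K, by positivity, fun x => ?_⟩
  · have h1 : Tendsto (fun n => ∑ j, Q i j * u (φ n) j - u (φ n) i) atTop
        (𝓝 (∑ j, Q i j * r j - r i)) :=
      (tendsto_finsetSum _ fun j _ => (hlim j).const_mul _).sub (hlim i)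
    have h2 : ∀ n, ∑ j, Q i j * u n j - u n i = (v (n + 1) i - v 0 i) / (n + 1 : ℝ) := by
      intro n
      simp only [hu, ← mul_div_assoc]
      rw [← Finset.sum_div, ← sub_div]
      congr 1
      simp only [Finset.mul_sum]
      rw [Finset.sum_comm]
      simp only [← hstep]
      rw [← Finset.sum_sub_distrib, Finset.sum_range_sub (fun m => v m i)]
    have h3 : Tendsto (fun n : ℕ => ∑ j, Q i j * u n j - u n i) atTop (𝓝 0) := by
      refine squeeze_zero_norm (a := fun n : ℕ => K / ((n : ℝ) + 1)) (fun n => ?_) ?_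
      · rw [h2, norm_div, Real.norm_eq_abs, Real.norm_eq_abs, abs_of_pos (hn1 n)]
        refine div_le_div_of_nonneg_right ?_ (hn1 n).le
        rw [abs_le]
        constructor <;> linarith [hup (n + 1) i, hup 0 i, hv0 (n + 1) i, hv0 0 i]
      · have := (tendsto_const_div_atTop_nhds_zero_nat K).comp (tendsto_add_atTop_nat 1)
        refine this.congr fun n => ?_
        simp
    exact sub_eq_zero.1 (tendsto_nhds_unique h1 (h3.comp hφ.tendsto_atTop))
  · have h1 : wordMass μ [x.1 0] ≤ K * r (x.1 0) :=
      ge_of_tendsto' ((hlim (x.1 0)).const_mul K) fun n => hulow (φ n) _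
    have h2 : (1 : ℝ) ≤ K * wordMass μ [x.1 0] := by
      have := (hKb x 0).2
      simpa [initWord] using this
    calc (1 : ℝ) ≤ _ := h2
      _ ≤ K * (K * r (x.1 0)) := mul_le_mul_of_nonneg_left h1 hK.le
      _ = _ := by ring

/-- Reference masses of words, given by path weights. -/
def refMass {α : Type*} [Fintype α] (Q : Matrix α α ℝ) (v : α → ℝ) : List α → ℝ
  | [] => ∑ a, v a
  | a :: w => pathWeight Q v a w

/-- An invariant Gibbs measure for a function of two coordinates is Markov, and its transition
probabilities come from `pairMatrix f` through a right eigenvector `r`. -/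
theorem exists_transition (hf : IsTwoCoordinate f) (hμ : IsInvariantGibbs μ f) :
    ∃ (c : ℝ) (r : Fin k → ℝ) (t : Fin k → Fin k → ℝ), 0 < c ∧ (∀ x : SFT A, 0 < r (x.1 0)) ∧
      (∀ i, 0 ≤ r i) ∧ (∀ i, ∑ j, c * pairMatrix f i j * r j = r i) ∧
      (∀ i j, t i j = c * pairMatrix f i j * r j / r i) ∧
      ∀ u i j, wordMass μ (u ++ [i] ++ [j]) = wordMass μ (u ++ [i]) * t i j := by
  obtain ⟨hμ0, P, C, hC, hb⟩ := hμ
  obtain ⟨r, hr0, hr, K, hK, hKr⟩ := exists_right_eigenvector hf hμ0 hC hb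
  obtain ⟨K', hK', hKb⟩ := exists_gibbs_succ hf hC hb
  set Q := Real.exp (-P) • pairMatrix f with hQ
  have hQ0 : ∀ i j, 0 ≤ Q i j := fun i j => by
    rw [hQ, Matrix.smul_apply, smul_eq_mul]
    exact mul_nonneg (Real.exp_pos _).le (pairMatrix_nonneg f i j)
  set t : Fin k → Fin k → ℝ := fun i j => Q i j * r j / r i with ht
  have hQt : ∀ i j, Q i j * r j = r i * t i j := by
    intro i j
    by_cases h0 : r i = 0
    · have := hr i
      rw [h0] at this ⊢
      rw [zero_mul]
      exact (Finset.sum_eq_zero_iff_of_nonneg fun j _ => mul_nonneg (hQ0 i j) (hr0 j)).1 this j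
        (Finset.mem_univ j)
    · simp only [ht]; field_simp
  refine ⟨Real.exp (-P), r, t, Real.exp_pos _, fun x => ?_, hr0, hr, fun _ _ => rfl,
    fun u i j => ?_⟩
  · exact pos_of_mul_pos_right (one_pos.trans_le (hKr x)) hK.le
  have hcons : ∀ a w, wordMass μ (a :: w) ≤ Real.exp (Real.log (K' * K)) * refMass Q r (a :: w) := by
    intro a w
    rw [Real.exp_log (by positivity)]
    by_cases h0 : (wordCyl A (a :: w)).Nonempty
    · obtain ⟨x, hx⟩ := h0
      have h1 := pathWeight_point hf P r w.length x
      have h2 := mem_wordCyl_cons.1 hx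
      rw [initWord_eq_of_mem h2.2, h2.1] at h1
      have h3 := (hKb x w.length).1
      have h4 : initWord (w.length + 1) x = a :: w := initWord_eq_of_mem hx
      rw [h4] at h3
      rw [refMass, h1]
      refine h3.trans ?_
      have h5 := hKr ((shift A)^[w.length] x)
      rw [shift_iterate_apply, add_zero] at h5
      have h6 : 0 < K' * Real.exp (-(w.length * P) + birkhoffSum (shift A) f w.length x) := by
        positivity
      nlinarith
    · rw [wordMass_eq_zero h0]
      exact mul_nonneg (by positivity) (pathWeight_nonneg hQ0 hr0 _ _)
  refine eq_mul_of_entropy (p := wordMass μ) (q := refMass Q r) (wordMass_nonneg μ) ?_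
    (sum_wordMass_append hμ0) (sum_wordMass_cons hμ0) ?_
    (c := fun _ => Real.log (K' * K)) (tendsto_const_div_atTop_nhds_zero_nat _) ?_ ?_ j
  · rintro (_ | ⟨a, w⟩)
    · exact Finset.sum_nonneg fun i _ => hr0 i
    · exact pathWeight_nonneg hQ0 hr0 a w
  · rintro (_ | ⟨a, w⟩)
    · rfl
    · exact sum_pathWeight_append hr a w
  · rintro (_ | ⟨a, w⟩)
    · rw [← sum_wordMass_append hμ0, refMass, Finset.mul_sum]
      exact Finset.sum_le_sum fun a _ => hcons a []
    · exact hcons a w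
  · intro w j
    rw [← List.append_assoc]
    cases w ++ u with
    | nil => exact hQt i j
    | cons a w' => exact pathWeight_append hQt a i j w'

end Markov

/-! ### The factor measure is a renewal measure -/

section Renewal

variable {A : Matrix (Fin 3) (Fin 3) ℕ} {B : Matrix (Fin 2) (Fin 2) ℕ} {π : SFT A → SFT B}
  {μ : Measure (SFT A)}

theorem IsOneBlockFactorMap.measurable (hπ : IsOneBlockFactorMap code π) : Measurable π := by
  have h : Measurable fun x => (π x).1 := by
    refine measurable_pi_lambda _ fun n => ?_
    simp only [hπ.oneBlock]
    exact (measurable_of_finite code).comp (measurable_coord n)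
  exact h.subtype_mk

theorem IsOneBlockFactorMap.isInvariantProb_map (hπ : IsOneBlockFactorMap code π)
    (hμ : IsInvariantProb μ) : IsInvariantProb (μ.map π) := by
  have := hμ.1
  refine ⟨Measure.isProbabilityMeasure_map hπ.measurable.aemeasurable, measurable_shift, ?_⟩
  rw [Measure.map_map measurable_shift hπ.measurable, ← hπ.semiconj.comp_eq,
    ← Measure.map_map hπ.measurable measurable_shift, hμ.2.map_eq]

theorem IsOneBlockFactorMap.wordMass_map (hπ : IsOneBlockFactorMap code π) (v : List (Fin 2)) :
    wordMass (μ.map π) v = μ.real {x | π x ∈ wordCyl B v} :=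
  map_measureReal_apply hπ.measurable (measurableSet_wordCyl v)

theorem IsOneBlockFactorMap.initWord_map (hπ : IsOneBlockFactorMap code π) (n : ℕ) (x : SFT A) :
    initWord n (π x) = (initWord n x).map code := by
  induction n generalizing x with
  | zero => rfl
  | succ n ih => rw [initWord, initWord, List.map_cons, ← ih, hπ.oneBlock, hπ.semiconj x]

theorem IsOneBlockFactorMap.wordMass_map_pos (hπ : IsOneBlockFactorMap code π)
    (hμ : IsInvariantProb μ) (hpos : ∀ w, (wordCyl A w).Nonempty → 0 < wordMass μ w)
    {v : List (Fin 2)} (hv : (wordCyl B v).Nonempty) : 0 < wordMass (μ.map π) v := by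
  have := hμ.1
  obtain ⟨y, hy⟩ := hv
  obtain ⟨x, rfl⟩ := hπ.surjective y
  refine (hpos _ ⟨x, mem_wordCyl_initWord v.length x⟩).trans_le ?_
  rw [hπ.wordMass_map]
  refine measureReal_mono fun z hz => ?_
  have h1 := initWord_eq_of_mem hz
  rw [length_initWord] at h1
  rw [Set.mem_ofPred_eq, wordCyl, Set.mem_ofPred_eq, hπ.initWord_map, h1, ← hπ.initWord_map]
  exact hy

theorem code_eq_zero {a : Fin 3} : code a = 0 ↔ a = 0 := by
  fin_cases a <;> simp [code]

/-- The conditional probability, given the current symbol `i` of the chain with transition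
probabilities `t`, that the images of the following symbols spell `v`. -/
noncomputable def fiberProb (t : Fin 3 → Fin 3 → ℝ) : Fin 3 → List (Fin 2) → ℝ
  | _, [] => 1
  | i, b :: v => ∑ a, if code a = b then t i a * fiberProb t a v else 0

/-- The mass of the points whose first symbols are mapped to `w`, the next ones are `u`, and the
ones after that are mapped to `v`. -/
noncomputable def mixedMass (π : SFT A → SFT B) (μ : Measure (SFT A)) (w : List (Fin 2))
    (u : List (Fin 3)) (v : List (Fin 2)) : ℝ :=
  μ.real {x | π x ∈ wordCyl B w ∧ (shift A)^[w.length] x ∈ wordCyl A u ∧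
    π ((shift A)^[w.length + u.length] x) ∈ wordCyl B v}

theorem IsOneBlockFactorMap.measurableSet_mixed (hπ : IsOneBlockFactorMap code π)
    (w : List (Fin 2)) (u : List (Fin 3)) (v : List (Fin 2)) :
    MeasurableSet {x | π x ∈ wordCyl B w ∧ (shift A)^[w.length] x ∈ wordCyl A u ∧
      π ((shift A)^[w.length + u.length] x) ∈ wordCyl B v} :=
  (hπ.measurable (measurableSet_wordCyl w)).inter
    (((measurable_shift.iterate _) (measurableSet_wordCyl u)).inter
      ((hπ.measurable.comp (measurable_shift.iterate _)) (measurableSet_wordCyl v)))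

theorem IsOneBlockFactorMap.mixedMass_cons (hπ : IsOneBlockFactorMap code π)
    (hμ : IsInvariantProb μ) (w : List (Fin 2)) (u : List (Fin 3)) (b : Fin 2)
    (v : List (Fin 2)) :
    mixedMass π μ w u (b :: v) = ∑ a, if code a = b then mixedMass π μ w (u ++ [a]) v else 0 := by
  have := hμ.1
  rw [mixedMass, ← sum_measureReal_coord μ (w.length + u.length) (hπ.measurableSet_mixed _ _ _)]
  refine Finset.sum_congr rfl fun a _ => ?_
  have hset : ∀ x : SFT A, π ((shift A)^[w.length + u.length] x) ∈ wordCyl B (b :: v) ↔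
      code (x.1 (w.length + u.length)) = b ∧
        π ((shift A)^[w.length + u.length + 1] x) ∈ wordCyl B v := by
    intro x
    rw [mem_wordCyl_cons, hπ.oneBlock, shift_iterate_apply, ← hπ.semiconj,
      Function.iterate_succ_apply']
    rfl
  split_ifs with h
  · rw [mixedMass]
    congr 1
    ext x
    simp only [Set.mem_ofPred_eq, hset, mem_wordCyl_append_singleton, shift_iterate_apply,
      List.length_append, List.length_singleton, ← add_assoc]
    constructor
    · rintro ⟨⟨h1, h2, -, h4⟩, h5⟩
      exact ⟨h1, ⟨h2, h5⟩, h4⟩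
    · rintro ⟨h1, ⟨h2, h5⟩, h4⟩
      exact ⟨⟨h1, h2, by rw [h5, h], h4⟩, h5⟩
  · rw [measureReal_eq_zero_iff]
    convert measure_empty (μ := μ)
    refine Set.eq_empty_iff_forall_notMem.2 ?_
    rintro x ⟨⟨-, -, h3⟩, h5⟩
    exact h (by rw [← h5]; exact ((hset x).1 h3).1)

theorem IsOneBlockFactorMap.mixedMass_append (hπ : IsOneBlockFactorMap code π)
    (hμ : IsInvariantProb μ) (w : List (Fin 2)) (u : List (Fin 3)) (b : Fin 2)
    (v : List (Fin 2)) :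
    mixedMass π μ (w ++ [b]) u v = ∑ a, if code a = b then mixedMass π μ w (a :: u) v else 0 := by
  have := hμ.1
  rw [mixedMass, ← sum_measureReal_coord μ w.length (hπ.measurableSet_mixed _ _ _)]
  refine Finset.sum_congr rfl fun a _ => ?_
  have hlen : ∀ x : SFT A, (shift A)^[w.length + 1 + u.length] x
      = (shift A)^[w.length + (u.length + 1)] x := fun x => by
    rw [add_assoc, add_comm 1]
  split_ifs with h
  · rw [mixedMass]
    congr 1
    ext x
    simp only [Set.mem_ofPred_eq, mem_wordCyl_append_singleton, mem_wordCyl_cons, hπ.oneBlock,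
      shift_iterate_apply, List.length_append, List.length_nil, List.length_cons, zero_add, hlen,
      add_zero, ← Function.iterate_succ_apply' (shift A)]
    constructor
    · rintro ⟨⟨⟨h1, -⟩, h2, h3⟩, h4⟩
      exact ⟨h1, ⟨h4, h2⟩, h3⟩
    · rintro ⟨h1, ⟨h4, h2⟩, h3⟩
      exact ⟨⟨⟨h1, by rw [h4, h]⟩, h2, h3⟩, h4⟩
  · rw [measureReal_eq_zero_iff]
    convert measure_empty (μ := μ)
    refine Set.eq_empty_iff_forall_notMem.2 ?_
    rintro x ⟨⟨h1, -⟩, h5⟩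
    refine h ?_
    rw [← h5, ← hπ.oneBlock]
    exact (mem_wordCyl_append_singleton.1 h1).2

theorem mixedMass_nil_nil (u : List (Fin 3)) : mixedMass π μ [] u [] = wordMass μ u := by
  simp [mixedMass, wordMass]

theorem IsOneBlockFactorMap.mixedMass_eq (hπ : IsOneBlockFactorMap code π)
    (w : List (Fin 2)) (v : List (Fin 2)) :
    mixedMass π μ w [] v = wordMass (μ.map π) (w ++ v) := by
  rw [hπ.wordMass_map, mixedMass]
  congr 1
  ext x
  simp only [Set.mem_ofPred_eq, mem_wordCyl_append, wordCyl_nil, Set.mem_univ, true_and,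
    List.length_nil, add_zero, hπ.semiconj.iterate_right _ x]

variable {t : Fin 3 → Fin 3 → ℝ}

/-- The Markov property for cylinders of the chain followed by cylinders of the factor. -/
theorem IsOneBlockFactorMap.mixedMass_markov (hπ : IsOneBlockFactorMap code π)
    (hμ : IsInvariantProb μ)
    (ht : ∀ u i j, wordMass μ (u ++ [i] ++ [j]) = wordMass μ (u ++ [i]) * t i j)
    (w : List (Fin 2)) (u : List (Fin 3)) (i : Fin 3) (v : List (Fin 2)) :
    mixedMass π μ w (u ++ [i]) v = mixedMass π μ w (u ++ [i]) [] * fiberProb t i v := by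
  induction w using List.reverseRecOn generalizing u with
  | nil =>
    induction v generalizing u i with
    | nil => simp [fiberProb]
    | cons b v ih =>
      rw [hπ.mixedMass_cons hμ, fiberProb, Finset.mul_sum]
      refine Finset.sum_congr rfl fun a _ => ?_
      split_ifs
      · rw [ih, mixedMass_nil_nil, mixedMass_nil_nil, ht, mul_assoc]
      · simp
  | append_singleton w b ih =>
    rw [hπ.mixedMass_append hμ, hπ.mixedMass_append hμ, Finset.sum_mul]
    refine Finset.sum_congr rfl fun a _ => ?_
    split_ifs
    · exact ih (a :: u)
    · simp

theorem IsOneBlockFactorMap.wordMass_map_cons (hπ : IsOneBlockFactorMap code π)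
    (hμ : IsInvariantProb μ)
    (ht : ∀ u i j, wordMass μ (u ++ [i] ++ [j]) = wordMass μ (u ++ [i]) * t i j)
    (b : Fin 2) (v : List (Fin 2)) :
    wordMass (μ.map π) (b :: v)
      = ∑ i, if code i = b then wordMass μ [i] * fiberProb t i v else 0 := by
  rw [← List.nil_append (b :: v), ← hπ.mixedMass_eq, hπ.mixedMass_cons hμ]
  refine Finset.sum_congr rfl fun a _ => ?_
  split_ifs
  · rw [hπ.mixedMass_markov hμ ht, mixedMass_nil_nil, List.nil_append]
  · rfl

/-- The symbol `0` has a single preimage, so that after an occurrence of `0` the factor measure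
forgets the past. -/
theorem IsOneBlockFactorMap.wordMass_map_renewal (hπ : IsOneBlockFactorMap code π)
    (hμ : IsInvariantProb μ)
    (ht : ∀ u i j, wordMass μ (u ++ [i] ++ [j]) = wordMass μ (u ++ [i]) * t i j)
    (w v : List (Fin 2)) :
    wordMass (μ.map π) (w ++ 0 :: v) = wordMass (μ.map π) (w ++ [0]) * fiberProb t 0 v := by
  rw [← hπ.mixedMass_eq, ← hπ.mixedMass_eq, hπ.mixedMass_cons hμ, hπ.mixedMass_cons hμ]
  simp only [code_eq_zero, Finset.sum_ite_eq', Finset.mem_univ, if_true]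
  exact hπ.mixedMass_markov hμ ht w [] 0 v

/-- The shift `X_B` contains all words `1 ⋯ 1 0`. -/
theorem wordCyl_replicate_nonempty (hB : B = !![1, 1; 1, 1] ∨ B = !![0, 1; 1, 1]) (n : ℕ) :
    (wordCyl B (List.replicate n 1 ++ [0])).Nonempty := by
  have hmem : (fun m => if m = n then 0 else 1 : ℕ → Fin 2) ∈ SFT B := by
    intro m
    rcases hB with rfl | rfl <;> simp only <;> split_ifs <;> first | rfl | omega
  refine ⟨⟨_, hmem⟩, mem_wordCyl_append_singleton.2 ⟨?_, by simp⟩⟩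
  have key : ∀ (j : ℕ) (x : SFT B), (∀ i < j, x.1 i = 1) →
      x ∈ wordCyl B (List.replicate j 1) := by
    intro j
    induction j with
    | zero => simp
    | succ j ih =>
      intro x hx
      exact mem_wordCyl_cons.2 ⟨hx 0 (by omega), ih _ fun i hi => hx (i + 1) (by omega)⟩
  exact key n _ fun i hi => if_neg hi.ne

theorem fiberProb_one_cons (i : Fin 3) (v : List (Fin 2)) :
    fiberProb t i (1 :: v) = t i 1 * fiberProb t 1 v + t i 2 * fiberProb t 2 v := by
  simp [fiberProb, Fin.sum_univ_three, code]

theorem fiberProb_zero (i : Fin 3) : fiberProb t i [0] = t i 0 := by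
  simp [fiberProb, Fin.sum_univ_three, code]

theorem IsOneBlockFactorMap.wordMass_map_one_cons (hπ : IsOneBlockFactorMap code π)
    (hμ : IsInvariantProb μ)
    (ht : ∀ u i j, wordMass μ (u ++ [i] ++ [j]) = wordMass μ (u ++ [i]) * t i j)
    (v : List (Fin 2)) :
    wordMass (μ.map π) (1 :: v)
      = wordMass μ [1] * fiberProb t 1 v + wordMass μ [2] * fiberProb t 2 v := by
  rw [hπ.wordMass_map_cons hμ ht]
  simp [Fin.sum_univ_three, code]

/-- From every symbol the chain reaches `0` with positive probability, so the mass of the words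
`1 ⋯ 1` decays exponentially. -/
theorem IsOneBlockFactorMap.exists_decay (hπ : IsOneBlockFactorMap code π)
    (hB : B = !![1, 1; 1, 1] ∨ B = !![0, 1; 1, 1]) (hirr : IsIrreducibleShift (SFT A))
    (hμ : IsInvariantProb μ) (hpos : ∀ w, (wordCyl A w).Nonempty → 0 < wordMass μ w)
    (ht0 : ∀ i j, 0 ≤ t i j) (ht1 : ∀ i, ∑ j, t i j ≤ 1)
    (htz : ∀ i j, ¬ (wordCyl A [i]).Nonempty → t i j = 0)
    (ht : ∀ u i j, wordMass μ (u ++ [i] ++ [j]) = wordMass μ (u ++ [i]) * t i j) :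
    ∃ K c : ℝ, 0 < c ∧ ∀ n : ℕ,
      wordMass (μ.map π) (List.replicate n 1) ≤ K * Real.exp (-(c * n)) := by
  have := hμ.1
  set h : ℕ → Fin 3 → ℝ := fun n i => fiberProb t i (List.replicate n 1) with hh
  have hsucc : ∀ n i, h (n + 1) i = t i 1 * h n 1 + t i 2 * h n 2 := fun n i =>
    fiberProb_one_cons i _
  have hzero : ∀ i, h 0 i = 1 := fun i => rfl
  have hmono : ∀ n i, h (n + 1) i ≤ h n i := by
    intro n
    induction n with
    | zero =>
      intro i
      have := ht1 i
      rw [Fin.sum_univ_three] at this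
      rw [hsucc, hzero, hzero, hzero]
      linarith [ht0 i 0]
    | succ n ih =>
      intro i
      rw [hsucc (n + 1) i, hsucc n i]
      exact add_le_add (mul_le_mul_of_nonneg_left (ih 1) (ht0 _ _))
        (mul_le_mul_of_nonneg_left (ih 2) (ht0 _ _))
  have hanti : ∀ i, Antitone fun n => h n i := fun i => antitone_nat_of_succ_le fun n => hmono n i
  have hexit : ∀ i, ∃ n, h n i < 1 := by
    intro i
    by_cases hi : (wordCyl A [i]).Nonempty
    · have hlang : ∀ a : Fin 3, (wordCyl A [a]).Nonempty → [a] ∈ language (SFT A) := by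
        rintro a ⟨x, hx⟩
        refine ⟨x.1, x.2, 0, fun j hj => ?_⟩
        match j, hj with
        | 0, _ => exact (mem_wordCyl_cons.1 hx).1
      have h0 : (wordCyl A [0]).Nonempty := by
        obtain ⟨y, hy⟩ := wordCyl_replicate_nonempty hB 0
        obtain ⟨x, rfl⟩ := hπ.surjective y
        refine ⟨x, mem_wordCyl_cons.2 ⟨?_, by simp⟩⟩
        rw [← code_eq_zero, ← hπ.oneBlock]
        exact (mem_wordCyl_cons.1 hy).1
      obtain ⟨w, -, hw⟩ := hirr _ (hlang i hi) _ (hlang 0 h0)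
      have hwp := hpos _ (wordCyl_nonempty_of_mem_language hw)
      refine ⟨w.length + 1, ?_⟩
      have h1 := hπ.mixedMass_markov hμ ht [] [] i (List.replicate (w.length + 1) 1)
      rw [List.nil_append, mixedMass_nil_nil] at h1
      have hpi := hpos _ hi
      have h2 : mixedMass π μ [] [i] (List.replicate (w.length + 1) 1)
          + wordMass μ ([i] ++ w ++ [0]) ≤ wordMass μ [i] := by
        rw [mixedMass, wordMass, wordMass, ← measureReal_union]
        · refine measureReal_mono ?_
          rintro x (⟨-, hx, -⟩ | hx)
          · exact hx
          · rw [List.append_assoc] at hx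
            exact (mem_wordCyl_append.1 hx).1
        · refine Set.disjoint_left.2 ?_
          rintro x ⟨-, -, h3⟩ h4
          have h5 := (mem_wordCyl_append_singleton.1 h4).2
          rw [List.replicate_succ', mem_wordCyl_append_singleton, hπ.oneBlock,
            shift_iterate_apply] at h3
          have h6 := h3.2
          simp only [List.length_nil, List.length_singleton, List.length_replicate, zero_add,
            List.length_append] at h5 h6
          rw [h5] at h6
          simp [code] at h6
        · exact measurableSet_wordCyl _
      have h3 : wordMass μ [i] * h (w.length + 1) i < wordMass μ [i] * 1 := by
        rw [hh, ← h1]; linarith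
      exact lt_of_mul_lt_mul_left h3 hpi.le
    · refine ⟨1, ?_⟩
      rw [hsucc, htz i 1 hi, htz i 2 hi]
      simp
  choose m hm using hexit
  set L := m 1 + m 2 + 1 with hL
  have hL1 : h L 1 < 1 := (hanti 1 (by omega)).trans_lt (hm 1)
  have hL2 : h L 2 < 1 := (hanti 2 (by omega)).trans_lt (hm 2)
  obtain ⟨θ, hθ0, hθ1, hθa, hθb⟩ : ∃ θ, 0 < θ ∧ θ < 1 ∧ h L 1 ≤ θ ∧ h L 2 ≤ θ :=
    ⟨max (1 / 2) (max (h L 1) (h L 2)), by positivity, by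
      rw [max_lt_iff, max_lt_iff]; exact ⟨by norm_num, hL1, hL2⟩,
      (le_max_left _ _).trans (le_max_right _ _), (le_max_right _ _).trans (le_max_right _ _)⟩
  have hstep : ∀ n, h (n + L) 1 ≤ θ * h n 1 ∧ h (n + L) 2 ≤ θ * h n 2 := by
    intro n
    induction n with
    | zero => rw [zero_add, hzero, hzero, mul_one]; exact ⟨hθa, hθb⟩
    | succ n ih =>
      have key : ∀ i, h (n + 1 + L) i ≤ θ * h (n + 1) i := by
        intro i
        rw [add_right_comm, hsucc, hsucc n]
        nlinarith [mul_le_mul_of_nonneg_left ih.1 (ht0 i 1),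
          mul_le_mul_of_nonneg_left ih.2 (ht0 i 2)]
      exact ⟨key 1, key 2⟩
  have hLpos : (0 : ℝ) < L := by rw [hL]; positivity
  set c := -Real.log θ / L with hc
  have hcpos : 0 < c := div_pos (neg_pos.2 (Real.log_neg hθ0 hθ1)) hLpos
  have hθc : θ = Real.exp (-(c * L)) := by
    rw [hc, div_mul_cancel₀ _ hLpos.ne', neg_neg, Real.exp_log hθ0]
  have hexp : ∀ n, h n 1 ≤ Real.exp (c * L) * Real.exp (-(c * n)) ∧
      h n 2 ≤ Real.exp (c * L) * Real.exp (-(c * n)) := by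
    intro n
    induction n using Nat.strong_induction_on with
    | _ n ih =>
      by_cases hn : n < L
      · have h1 : (1 : ℝ) ≤ Real.exp (c * L) * Real.exp (-(c * n)) := by
          rw [← Real.exp_add, Real.one_le_exp_iff]
          have : (n : ℝ) ≤ L := by exact_mod_cast hn.le
          nlinarith
        exact ⟨(hanti 1 (Nat.zero_le n)).trans h1, (hanti 2 (Nat.zero_le n)).trans h1⟩
      · obtain ⟨j, rfl⟩ := Nat.exists_eq_add_of_le' (not_lt.1 hn)
        have h1 := ih j (by omega)
        have h2 : Real.exp (c * L) * Real.exp (-(c * ((j + L : ℕ) : ℝ)))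
            = θ * (Real.exp (c * L) * Real.exp (-(c * j))) := by
          rw [hθc, ← Real.exp_add, ← Real.exp_add, ← Real.exp_add]
          congr 1; push_cast; ring
        rw [h2]
        exact ⟨(hstep j).1.trans (mul_le_mul_of_nonneg_left h1.1 hθ0.le),
          (hstep j).2.trans (mul_le_mul_of_nonneg_left h1.2 hθ0.le)⟩
  refine ⟨Real.exp (c * L) * Real.exp c, c, hcpos, fun n => ?_⟩
  cases n with
  | zero =>
    rw [List.replicate_zero, wordMass_nil (hπ.isInvariantProb_map hμ)]
    rw [← Real.exp_add, ← Real.exp_add, Real.one_le_exp_iff]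
    push_cast
    nlinarith
  | succ n =>
    rw [List.replicate_succ, hπ.wordMass_map_one_cons hμ ht]
    have h1 := hexp n
    have h2 : wordMass μ [1] + wordMass μ [2] ≤ 1 := by
      have := sum_wordMass_append hμ []
      rw [Fin.sum_univ_three, wordMass_nil hμ] at this
      simp only [List.nil_append] at this
      linarith [wordMass_nonneg μ [0]]
    have h3 : Real.exp (c * L) * Real.exp c * Real.exp (-(c * ((n + 1 : ℕ) : ℝ)))
        = Real.exp (c * L) * Real.exp (-(c * n)) := by
      rw [← Real.exp_add, ← Real.exp_add, ← Real.exp_add]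
      congr 1; push_cast; ring
    rw [h3]
    have h4 : 0 ≤ Real.exp (c * L) * Real.exp (-(c * n)) := by positivity
    nlinarith [mul_le_mul_of_nonneg_left h1.1 (wordMass_nonneg μ [1]),
      mul_le_mul_of_nonneg_left h1.2 (wordMass_nonneg μ [2])]

end Renewal

/-! ### The relative pressure sequence and the factor measure -/

section RelativePressure

theorem AdditivityBound.of_comparable {k : ℕ} {A : Matrix (Fin k) (Fin k) ℕ}
    {F G : ℕ → SFT A → ℝ} {P C c : ℝ} (hC : 0 < C)
    (hF : ∀ n x, 1 ≤ n → 0 ≤ F n x) (hG : ∀ n x, 1 ≤ n → 0 ≤ G n x)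
    (h1 : ∀ (n : ℕ) x, 1 ≤ n → F n x ≤ C * (Real.exp (n * P) * G n x))
    (h2 : ∀ (n : ℕ) x, 1 ≤ n → Real.exp (n * P) * G n x ≤ C * F n x)
    {n m : ℕ} (hn : 1 ≤ n) (hm : 1 ≤ m) {x : SFT A} (h : AdditivityBound G c n m x) :
    AdditivityBound F (c + 3 * Real.log C) n m x := by
  set z := (shift A)^[n] x with hz
  have hexp : Real.exp ((n + m : ℕ) * P) = Real.exp (n * P) * Real.exp (m * P) := by
    rw [← Real.exp_add]; congr 1; push_cast; ring
  have hc3 : Real.exp (c + 3 * Real.log C) = C ^ 3 * Real.exp c := by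
    rw [Real.exp_add, mul_comm, ← Real.exp_log (pow_pos hC 3), Real.log_pow]
    push_cast; rfl
  have hnm : 1 ≤ n + m := by omega
  have hGn : 0 ≤ Real.exp (n * P) * G n x := mul_nonneg (Real.exp_pos _).le (hG n x hn)
  have hGm : 0 ≤ Real.exp (m * P) * G m z := mul_nonneg (Real.exp_pos _).le (hG m z hm)
  constructor
  · calc F (n + m) x ≤ C * (Real.exp ((n + m : ℕ) * P) * G (n + m) x) := h1 _ _ hnm
      _ ≤ C * (Real.exp ((n + m : ℕ) * P) * (Real.exp c * G n x * G m z)) :=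
        mul_le_mul_of_nonneg_left
          (mul_le_mul_of_nonneg_left h.1 (Real.exp_pos _).le) hC.le
      _ = C * Real.exp c * ((Real.exp (n * P) * G n x) * (Real.exp (m * P) * G m z)) := by
        rw [hexp]; ring
      _ ≤ C * Real.exp c * ((C * F n x) * (C * F m z)) := by
        refine mul_le_mul_of_nonneg_left ?_ (by positivity)
        exact mul_le_mul (h2 n x hn) (h2 m z hm) hGm (mul_nonneg hC.le (hF n x hn))
      _ = _ := by rw [hc3]; ring
  · rw [Real.exp_neg, mul_assoc, inv_mul_le_iff₀ (Real.exp_pos _), hc3]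
    have h3 := h.2
    rw [Real.exp_neg, mul_assoc, inv_mul_le_iff₀ (Real.exp_pos _)] at h3
    calc F n x * F m z
        ≤ (C * (Real.exp (n * P) * G n x)) * (C * (Real.exp (m * P) * G m z)) :=
        mul_le_mul (h1 n x hn) (h1 m z hm) (hF m z hm) (mul_nonneg hC.le hGn)
      _ = C ^ 2 * Real.exp ((n + m : ℕ) * P) * (G n x * G m z) := by rw [hexp]; ring
      _ ≤ C ^ 2 * Real.exp ((n + m : ℕ) * P) * (Real.exp c * G (n + m) x) :=
        mul_le_mul_of_nonneg_left h3 (by positivity)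
      _ = C ^ 2 * Real.exp c * (Real.exp ((n + m : ℕ) * P) * G (n + m) x) := by ring
      _ ≤ C ^ 2 * Real.exp c * (C * F (n + m) x) :=
        mul_le_mul_of_nonneg_left (h2 _ _ hnm) (by positivity)
      _ = _ := by ring

variable {A : Matrix (Fin 3) (Fin 3) ℕ} {B : Matrix (Fin 2) (Fin 2) ℕ} {π : SFT A → SFT B}
  {μ : Measure (SFT A)} {f : SFT A → ℝ}

theorem exists_isFiberSelection (π : SFT A → SFT B) (n : ℕ) (y : SFT B) :
    ∃ E, IsFiberSelection π n y E := by
  obtain ⟨S, hS, hbij⟩ := (π ⁻¹' cyl n y).exists_subset_bijOn (initWord n)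
  have hfin : S.Finite := by
    rw [hbij.finite_iff_finite]
    refine (List.finite_length_eq (Fin 3) n).subset ?_
    rintro _ ⟨x, -, rfl⟩
    exact length_initWord n x
  refine ⟨hfin.toFinset, fun e he => hS (hfin.mem_toFinset.1 he), fun x hx => ?_⟩
  obtain ⟨e, he, hex⟩ := hbij.surjOn ⟨x, hx, rfl⟩
  refine ⟨e, ⟨hfin.mem_toFinset.2 he, initWord_eq_iff.1 hex⟩, ?_⟩
  rintro e' ⟨he', hex'⟩
  exact hbij.injOn (hfin.mem_toFinset.1 he') he ((initWord_eq_iff.2 hex').trans hex.symm)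

theorem IsOneBlockFactorMap.wordMass_eq_sum (hπ : IsOneBlockFactorMap code π)
    (hμ : IsInvariantProb μ) {n : ℕ} {y : SFT B} {E : Finset (SFT A)}
    (hE : IsFiberSelection π n y E) :
    wordMass (μ.map π) (initWord n y) = ∑ e ∈ E, wordMass μ (initWord n e) := by
  have := hμ.1
  rw [hπ.wordMass_map]
  simp only [wordMass]
  rw [← measureReal_biUnion_finset]
  · congr 1
    ext x
    simp only [Set.mem_ofPred_eq, Set.mem_iUnion, ← cyl_eq_wordCyl, exists_prop]
    constructor
    · intro hx
      obtain ⟨e, ⟨he, hex⟩, -⟩ := hE.2 x hx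
      exact ⟨e, he, initWord_eq_iff.1 (initWord_eq_iff.2 hex).symm⟩
    · rintro ⟨e, he, hex⟩
      have h1 := hE.1 e he
      rw [← initWord_eq_iff] at h1 hex ⊢
      rw [← h1, hπ.initWord_map, hπ.initWord_map, hex]
  · intro e he e' he' hne
    refine Set.disjoint_left.2 fun x hx hx' => hne ?_
    replace hx : x ∈ wordCyl A (initWord n e) := hx
    replace hx' : x ∈ wordCyl A (initWord n e') := hx'
    rw [← cyl_eq_wordCyl] at hx hx'
    have h1 := hE.1 e he
    refine (hE.2 e h1).unique ⟨he, initWord_eq_iff.1 rfl⟩ ⟨he', ?_⟩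
    rw [← initWord_eq_iff] at hx hx' ⊢
    rw [← hx, ← hx']
  · exact fun e _ => measurableSet_wordCyl _

/-- Up to bounded factors, `relSeq π f n` is the mass that the factor measure gives to cylinders of
length `n`, scaled by the pressure. -/
theorem IsOneBlockFactorMap.relSeq_comparable (hπ : IsOneBlockFactorMap code π)
    (hμ : IsInvariantGibbs μ f) :
    ∃ P C : ℝ, 0 < C ∧ ∀ (n : ℕ) (y : SFT B), 1 ≤ n → 0 ≤ relSeq π f n y ∧
      relSeq π f n y ≤ C * (Real.exp (n * P) * wordMass (μ.map π) (initWord n y)) ∧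
      Real.exp (n * P) * wordMass (μ.map π) (initWord n y) ≤ C * relSeq π f n y := by
  obtain ⟨hμ0, P, C, hC, hb⟩ := hμ
  refine ⟨P, C, hC, fun n y hn => ?_⟩
  have hexp : ∀ x : SFT A, Real.exp (birkhoffSum (shift A) f n x)
      = Real.exp (n * P) * Real.exp (-(n * P) + birkhoffSum (shift A) f n x) := fun x => by
    rw [← Real.exp_add]; congr 1; ring
  have hup : ∀ E, IsFiberSelection π n y E → ∑ x ∈ E, Real.exp (birkhoffSum (shift A) f n x)
      ≤ C * (Real.exp (n * P) * wordMass (μ.map π) (initWord n y)) := by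
    intro E hE
    rw [hπ.wordMass_eq_sum hμ0 hE, Finset.mul_sum, Finset.mul_sum]
    refine Finset.sum_le_sum fun x _ => ?_
    rw [hexp, mul_left_comm]
    exact mul_le_mul_of_nonneg_left ((hb x n hn).le_wordMass hC) (Real.exp_pos _).le
  have hbdd : BddAbove (Set.range fun E : {E : Finset (SFT A) // IsFiberSelection π n y E} =>
      ∑ x ∈ E.1, Real.exp (birkhoffSum (shift A) f n x)) := by
    refine ⟨C * (Real.exp (n * P) * wordMass (μ.map π) (initWord n y)), ?_⟩
    rintro _ ⟨E, rfl⟩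
    exact hup E.1 E.2
  obtain ⟨E, hE⟩ := exists_isFiberSelection π n y
  have hle : ∑ x ∈ E, Real.exp (birkhoffSum (shift A) f n x) ≤ relSeq π f n y :=
    le_ciSup hbdd ⟨E, hE⟩
  have : Nonempty {E : Finset (SFT A) // IsFiberSelection π n y E} := ⟨⟨E, hE⟩⟩
  refine ⟨(Finset.sum_nonneg fun x _ => (Real.exp_pos _).le).trans hle,
    ciSup_le fun E => hup E.1 E.2, le_trans ?_ (mul_le_mul_of_nonneg_left hle hC.le)⟩
  rw [hπ.wordMass_eq_sum hμ0 hE, Finset.mul_sum, Finset.mul_sum]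
  refine Finset.sum_le_sum fun x _ => ?_
  rw [hexp, mul_left_comm]
  exact mul_le_mul_of_nonneg_left (hb x n hn).wordMass_le (Real.exp_pos _).le

/-- Additivity of the relative pressure sequence, read on the cylinder masses of the factor. -/
theorem IsOneBlockFactorMap.exists_additivity_iff (hπ : IsOneBlockFactorMap code π)
    (hμ : IsInvariantGibbs μ f) :
    ∃ D : ℝ, 0 ≤ D ∧ ∀ (c : ℝ) (n m : ℕ) (y : SFT B), 1 ≤ n → 1 ≤ m →
      (AdditivityBound (relSeq π f) c n m y →
        AdditivityBound (fun n y => wordMass (μ.map π) (initWord n y)) (c + D) n m y) ∧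
      (AdditivityBound (fun n y => wordMass (μ.map π) (initWord n y)) c n m y →
        AdditivityBound (relSeq π f) (c + D) n m y) := by
  obtain ⟨P, C, hC, hb⟩ := hπ.relSeq_comparable hμ
  set C' := max C 1 with hC'
  have hC'0 : 0 < C' := hC.trans_le (le_max_left _ _)
  have hC1 : C ≤ C' := le_max_left _ _
  have hN : ∀ n (y : SFT B), 0 ≤ wordMass (μ.map π) (initWord n y) := fun n y =>
    wordMass_nonneg _ _
  refine ⟨3 * Real.log C', mul_nonneg (by norm_num) (Real.log_nonneg (le_max_right _ _)),
    fun c n m y hn hm => ⟨fun h => ?_, fun h => ?_⟩⟩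
  · refine AdditivityBound.of_comparable (P := -P) (F := fun n y =>
      wordMass (μ.map π) (initWord n y)) hC'0 (fun n y _ => hN n y)
      (fun n y hn => (hb n y hn).1) (fun n y hn => ?_) (fun n y hn => ?_) hn hm h
    · have h1 := (hb n y hn).2.2
      rw [mul_neg, Real.exp_neg, mul_left_comm, le_inv_mul_iff₀ (Real.exp_pos _)]
      exact h1.trans (mul_le_mul_of_nonneg_right hC1 (hb n y hn).1)
    · have h1 := (hb n y hn).2.1
      rw [mul_neg, Real.exp_neg, inv_mul_le_iff₀ (Real.exp_pos _), mul_left_comm]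
      exact h1.trans (mul_le_mul_of_nonneg_right hC1
        (mul_nonneg (Real.exp_pos _).le (hN n y)))
  · refine AdditivityBound.of_comparable (P := P) hC'0 (fun n y hn => (hb n y hn).1)
      (fun n y _ => hN n y) (fun n y hn => ?_) (fun n y hn => ?_) hn hm h
    · exact (hb n y hn).2.1.trans (mul_le_mul_of_nonneg_right hC1
        (mul_nonneg (Real.exp_pos _).le (hN n y)))
    · exact (hb n y hn).2.2.trans (mul_le_mul_of_nonneg_right hC1 (hb n y hn).1)

/-- A Gibbs measure for a function has almost additive cylinder masses. -/
theorem IsOneBlockFactorMap.almostAdditive_of_gibbs (hπ : IsOneBlockFactorMap code π)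
    (hμ : IsInvariantGibbs μ f) {g : SFT B → ℝ} (hg : IsInvariantGibbs (μ.map π) g) :
    AlmostAdditive (relSeq π f) := by
  obtain ⟨D, hD, hb⟩ := hπ.exists_additivity_iff hμ
  obtain ⟨-, P, C, hC, hgb⟩ := hg
  set C' := max C 1 with hC'
  have hC'0 : 0 < C' := hC.trans_le (le_max_left _ _)
  have hC1 : C ≤ C' := le_max_left _ _
  have hN : ∀ n (y : SFT B), 0 ≤ wordMass (μ.map π) (initWord n y) := fun n y =>
    wordMass_nonneg _ _
  refine ⟨0 + 3 * Real.log C' + D + 1, ?_, fun y n m hn hm => ?_⟩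
  · have := Real.log_nonneg (le_max_right C 1)
    positivity
  have h1 : AdditivityBound (fun n y => Real.exp (-(n * P) + birkhoffSum (shift B) g n y))
      0 n m y := by
    have h2 : Real.exp (-((n + m : ℕ) * P) + birkhoffSum (shift B) g (n + m) y)
        = Real.exp (-(n * P) + birkhoffSum (shift B) g n y) *
          Real.exp (-(m * P) + birkhoffSum (shift B) g m ((shift B)^[n] y)) := by
      rw [birkhoffSum_add, ← Real.exp_add]; congr 1; push_cast; ring
    simp only [AdditivityBound, h2, neg_zero, Real.exp_zero, one_mul, le_refl, and_self]
  have h3 := AdditivityBound.of_comparable (P := 0) (F := fun n y =>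
      wordMass (μ.map π) (initWord n y)) hC'0 (fun n y _ => hN n y)
      (fun n y hn => (Real.exp_pos _).le) (fun n y hn => ?_) (fun n y hn => ?_) hn hm h1
  · have h4 := (hb _ n m y hn hm).2 h3
    -- Enlarging the constant keeps both inequalities and makes it positive.
    have hpos : ∀ j (z : SFT B), 1 ≤ j → 0 ≤ relSeq π f j z := by
      obtain ⟨_, _, _, h⟩ := hπ.relSeq_comparable hμ
      exact fun j z hj => (h j z hj).1
    have hab := mul_nonneg (hpos n y hn) (hpos m ((shift B)^[n] y) hm)
    refine ⟨h4.1.trans ?_, le_trans ?_ h4.2⟩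
    · rw [mul_assoc, mul_assoc]
      exact mul_le_mul_of_nonneg_right (Real.exp_le_exp.2 (by linarith)) hab
    · rw [mul_assoc, mul_assoc]
      exact mul_le_mul_of_nonneg_right (Real.exp_le_exp.2 (by linarith)) hab
  · rw [mul_zero, Real.exp_zero, one_mul]
    exact (hgb y n hn).wordMass_le.trans
      (mul_le_mul_of_nonneg_right hC1 (Real.exp_pos _).le)
  · rw [mul_zero, Real.exp_zero, one_mul]
    exact ((hgb y n hn).le_wordMass hC).trans (mul_le_mul_of_nonneg_right hC1 (hN n y))

end RelativePressure

/-! ### Almost additive sequences of reals -/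

section RealSequences

/-- A sequence that is additive up to `c n = o(n)` has a rate `ℓ`, and differs from `n * ℓ` by at
most `c n`. -/
theorem exists_rate {a c : ℕ → ℝ}
    (h : ∀ n m, 1 ≤ n → 1 ≤ m → |a (n + m) - a n - a m| ≤ c n)
    (hc : Tendsto (fun n : ℕ => c n / n) atTop (𝓝 0)) :
    ∃ ℓ, ∀ n : ℕ, 1 ≤ n → |a n - n * ℓ| ≤ c n := by
  have hc0 : ∀ n, 1 ≤ n → 0 ≤ c n := fun n hn => (abs_nonneg _).trans (h n 1 hn le_rfl)
  have hmul : ∀ n, 1 ≤ n → ∀ k : ℕ, |a ((k + 1) * n) - (k + 1 : ℕ) * a n| ≤ (k + 1 : ℕ) * c n := by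
    intro n hn k
    induction k with
    | zero => simpa using hc0 n hn
    | succ k ih =>
      have h1 := h n ((k + 1) * n) hn (Nat.mul_pos (by omega) hn)
      rw [show (k + 1 + 1) * n = n + (k + 1) * n by ring]
      rw [abs_le] at h1 ih ⊢
      push_cast at *
      constructor <;> linarith [h1.1, h1.2, ih.1, ih.2]
  have hpair : ∀ n m : ℕ, 1 ≤ n → 1 ≤ m → |a n / n - a m / m| ≤ c n / n + c m / m := by
    intro n m hn hm
    have hn' : (0 : ℝ) < n := by exact_mod_cast hn
    have hm' : (0 : ℝ) < m := by exact_mod_cast hm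
    obtain ⟨k, rfl⟩ := Nat.exists_eq_add_of_le' hm
    obtain ⟨j, rfl⟩ := Nat.exists_eq_add_of_le' hn
    have h1 := hmul (j + 1) hn k
    have h2 := hmul (k + 1) hm j
    rw [mul_comm (j + 1) (k + 1)] at h2
    rw [div_sub_div _ _ hn'.ne' hm'.ne', div_add_div _ _ hn'.ne' hm'.ne', abs_div,
      abs_of_pos (mul_pos hn' hm')]
    refine div_le_div_of_nonneg_right ?_ (mul_pos hn' hm').le
    rw [abs_le] at *
    constructor <;> linarith [h1.1, h1.2, h2.1, h2.2]
  have hcauchy : CauchySeq fun n : ℕ => a n / n := by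
    rw [Metric.cauchySeq_iff]
    intro ε hε
    obtain ⟨N, hN⟩ := eventually_atTop.1 (hc.eventually (gt_mem_nhds (half_pos hε)))
    refine ⟨N + 1, fun m hm n hn => ?_⟩
    rw [Real.dist_eq]
    have h1 := hN m (by omega)
    have h2 := hN n (by omega)
    exact (hpair m n (by omega) (by omega)).trans_lt (by linarith)
  obtain ⟨ℓ, hℓ⟩ := cauchySeq_tendsto_of_complete hcauchy
  refine ⟨ℓ, fun n hn => ?_⟩
  have hn' : (0 : ℝ) < n := by exact_mod_cast hn
  have h1 : |a n / n - ℓ| ≤ c n / n + 0 := by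
    refine le_of_tendsto_of_tendsto ((hℓ.const_sub (a n / n)).abs) (hc.const_add (c n / n)) ?_
    filter_upwards [eventually_ge_atTop 1] with m hm using hpair n m hn hm
  rw [add_zero] at h1
  have h2 : a n - n * ℓ = n * (a n / n - ℓ) := by field_simp
  rw [h2, abs_mul, abs_of_pos hn']
  calc (n : ℝ) * |a n / n - ℓ| ≤ n * (c n / n) := mul_le_mul_of_nonneg_left h1 hn'.le
    _ = c n := by field_simp

/-- A sublinear sequence has a monotone sublinear majorant. -/
theorem exists_monotone_majorant {c : ℕ → ℝ}
    (hc : Tendsto (fun n : ℕ => c n / n) atTop (𝓝 0)) :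
    ∃ c' : ℕ → ℝ, Monotone c' ∧ (∀ n, 0 ≤ c' n) ∧ (∀ n, c n ≤ c' n) ∧
      Tendsto (fun n : ℕ => c' n / n) atTop (𝓝 0) := by
  set c' : ℕ → ℝ := fun n => partialSups (fun n => |c n|) n with hc'
  have hle : ∀ n, |c n| ≤ c' n := fun n => le_partialSups (fun n => |c n|) n
  have h0 : ∀ n, 0 ≤ c' n := fun n => (abs_nonneg _).trans (hle n)
  refine ⟨c', (partialSups fun n => |c n|).monotone, h0,
    fun n => (le_abs_self _).trans (hle n), ?_⟩
  rw [Metric.tendsto_atTop]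
  intro ε hε
  obtain ⟨N, hN⟩ := Metric.tendsto_atTop.1 hc (ε / 2) (half_pos hε)
  obtain ⟨N', hN'⟩ := Metric.tendsto_atTop.1
    (tendsto_const_div_atTop_nhds_zero_nat (c' N)) (ε / 2) (half_pos hε)
  refine ⟨N' + 1, fun n hn => ?_⟩
  have hn' : (0 : ℝ) < n := by exact_mod_cast (show 0 < n by omega)
  have h1 : c' n ≤ c' N + ε / 2 * n := by
    refine partialSups_le _ _ _ fun m hm => ?_
    rcases le_total m N with hmN | hmN
    · have : |c m| ≤ c' N := (hle m).trans ((partialSups fun n => |c n|).monotone hmN)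
      have : 0 ≤ ε / 2 * n := by positivity
      linarith
    · rcases Nat.eq_zero_or_pos m with rfl | hm0
      · have : |c 0| ≤ c' N := (hle 0).trans ((partialSups fun n => |c n|).monotone (Nat.zero_le N))
        have : 0 ≤ ε / 2 * n := by positivity
        linarith
      have hm' : (0 : ℝ) < m := by exact_mod_cast hm0
      have h2 := hN m hmN
      rw [Real.dist_eq, sub_zero, abs_div, abs_of_pos hm', div_lt_iff₀ hm'] at h2
      have h3 : (m : ℝ) ≤ n := by exact_mod_cast hm
      have h4 : ε / 2 * m ≤ ε / 2 * n := mul_le_mul_of_nonneg_left h3 (half_pos hε).le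
      linarith [h0 N]
  have h2 := hN' n (by omega)
  rw [Real.dist_eq, sub_zero] at h2 ⊢
  rw [abs_of_nonneg (div_nonneg (h0 _) hn'.le)] at h2 ⊢
  rw [div_lt_iff₀ hn'] at h2 ⊢
  linarith

end RealSequences

/-! ### The potential of a renewal measure -/

section Potential

variable {B : Matrix (Fin 2) (Fin 2) ℕ} {ν : Measure (SFT B)}

/-- An invariant probability measure of full support on a two-symbol shift that forgets the past at
each occurrence of `0`, and for which the mass of `1 ⋯ 1` decays exponentially. -/
structure IsRenewal (ν : Measure (SFT B)) : Prop where
  inv : IsInvariantProb ν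
  pos : ∀ w, (wordCyl B w).Nonempty → 0 < wordMass ν w
  nonempty : ∀ n, (wordCyl B (List.replicate n 1 ++ [0])).Nonempty
  renewal : ∃ τ : List (Fin 2) → ℝ, ∀ w v,
    wordMass ν (w ++ 0 :: v) = wordMass ν (w ++ [0]) * τ v
  decay : ∃ K c : ℝ, 0 < c ∧ ∀ n : ℕ,
    wordMass ν (List.replicate n 1) ≤ K * Real.exp (-(c * n))

/-- The mass of the word `1 ⋯ 1 0` with `a` symbols `1`. -/
noncomputable def gapMass (ν : Measure (SFT B)) (a : ℕ) : ℝ :=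
  wordMass ν (List.replicate a 1 ++ [0])

/-- The conditional probability that a point starts with `1`, given that its shift starts with the
word `1 ⋯ 1 0` with `a` symbols `1`. -/
noncomputable def gapRatio (ν : Measure (SFT B)) (a : ℕ) : ℝ := gapMass ν (a + 1) / gapMass ν a

open Classical in
/-- The value `θ a`, where `a + 1` is the position of the first `0` of `y` after position `0`, and
`lam` if there is no such `0`. -/
noncomputable def gapFun (θ : ℕ → ℝ) (lam : ℝ) (y : SFT B) : ℝ :=
  if h : ∃ a, y.1 (a + 1) = 0 then θ (Nat.find h) else lam

/-- The conditional probability of the first symbol of `y` given the following ones, if `θ` is the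
gap ratio of the measure; `lam` stands for its undefined value at infinite gaps. -/
noncomputable def symbolProb (θ : ℕ → ℝ) (lam : ℝ) (y : SFT B) : ℝ :=
  if y.1 0 = 1 then gapFun θ lam y else 1 - gapFun θ lam y

theorem gapFun_eq {θ : ℕ → ℝ} {lam : ℝ} {y : SFT B} {a : ℕ} (h1 : ∀ i < a, y.1 (i + 1) ≠ 0)
    (h2 : y.1 (a + 1) = 0) : gapFun θ lam y = θ a := by
  have h : ∃ a, y.1 (a + 1) = 0 := ⟨a, h2⟩
  classical
  have hf : Nat.find h = a := (Nat.find_eq_iff h).2 ⟨h2, h1⟩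
  rw [gapFun, dif_pos h]
  congr 1

theorem gapFun_eq_of_forall {θ : ℕ → ℝ} {lam : ℝ} {y : SFT B} (h : ∀ a, y.1 (a + 1) ≠ 0) :
    gapFun θ lam y = lam := by
  rw [gapFun, dif_neg]
  push Not
  exact h

theorem exists_first_gap {y : SFT B} {b : ℕ} (hb : y.1 (b + 1) = 0) :
    ∃ a ≤ b, (∀ i < a, y.1 (i + 1) ≠ 0) ∧ y.1 (a + 1) = 0 := by
  classical
  have h : ∃ a, y.1 (a + 1) = 0 := ⟨b, hb⟩
  exact ⟨Nat.find h, Nat.find_min' h hb, fun i hi => Nat.find_min h hi, Nat.find_spec h⟩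

theorem fin_two_eq_one_of_ne {a : Fin 2} (h : a ≠ 0) : a = 1 := by omega

theorem fin_two_eq_zero_of_ne {a : Fin 2} (h : a ≠ 1) : a = 0 := by omega

theorem initWord_eq_replicate {y : SFT B} {n : ℕ} {b : Fin 2} (h : ∀ i < n, y.1 i = b) :
    initWord n y = List.replicate n b := by
  induction n generalizing y with
  | zero => rfl
  | succ n ih =>
    rw [initWord, List.replicate_succ, h 0 (by omega),
      ih (y := shift B y) fun i hi => h (i + 1) (by omega)]

theorem eq_replicate_append_of_mem {y : SFT B} {w : List (Fin 2)} (hw : y ∈ wordCyl B w) {a : ℕ}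
    (ha : a < w.length) (h1 : ∀ i < a, y.1 i ≠ 0) (h2 : y.1 a = 0) :
    ∃ v, w = List.replicate a 1 ++ 0 :: v := by
  obtain ⟨m, hm⟩ := Nat.exists_eq_add_of_le ha
  refine ⟨initWord m ((shift B)^[a + 1] y), ?_⟩
  have h := initWord_eq_of_mem hw
  rw [hm, Nat.succ_eq_add_one, initWord_add, initWord_succ_right, h2,
    initWord_eq_replicate fun i hi => fin_two_eq_one_of_ne (h1 i hi)] at h
  rw [← h]; simp

namespace IsRenewal

theorem gapMass_pos (hν : IsRenewal ν) (a : ℕ) : 0 < gapMass ν a := hν.pos _ (hν.nonempty a)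

theorem gapRatio_pos (hν : IsRenewal ν) (a : ℕ) : 0 < gapRatio ν a :=
  div_pos (hν.gapMass_pos _) (hν.gapMass_pos _)

theorem sum_cons (hν : IsRenewal ν) (w : List (Fin 2)) :
    wordMass ν (0 :: w) + wordMass ν (1 :: w) = wordMass ν w := by
  rw [← sum_wordMass_cons hν.inv w, Fin.sum_univ_two]

theorem gapRatio_le_one (hν : IsRenewal ν) (a : ℕ) : gapRatio ν a ≤ 1 := by
  rw [gapRatio, div_le_one (hν.gapMass_pos a), gapMass, gapMass, List.replicate_succ,
    List.cons_append, ← hν.sum_cons (List.replicate a 1 ++ [0])]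
  linarith [wordMass_nonneg ν (0 :: (List.replicate a 1 ++ [0]))]

theorem wordMass_mul (hν : IsRenewal ν) (w v : List (Fin 2)) :
    wordMass ν (w ++ 0 :: v) * wordMass ν [0] = wordMass ν (w ++ [0]) * wordMass ν (0 :: v) := by
  obtain ⟨τ, hτ⟩ := hν.renewal
  have h1 := hτ [] v
  simp only [List.nil_append] at h1
  rw [hτ, h1]; ring

theorem wordMass_zero_pos (hν : IsRenewal ν) : 0 < wordMass ν [0] := by
  simpa [gapMass] using hν.gapMass_pos 0

/-- On cylinders of words that end in `0`, `symbolProb` is the conditional probability of the first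
symbol. -/
theorem wordMass_cons (hν : IsRenewal ν) {lam : ℝ} {y : SFT B} {b : Fin 2} {w : List (Fin 2)}
    (hy : y ∈ wordCyl B (b :: (w ++ [0]))) :
    0 < symbolProb (gapRatio ν) lam y ∧
      wordMass ν (b :: (w ++ [0])) = symbolProb (gapRatio ν) lam y * wordMass ν (w ++ [0]) := by
  have hy1 := mem_wordCyl_cons.1 hy
  have hlast : y.1 (w.length + 1) = 0 := (mem_wordCyl_append_singleton.1 hy1.2).2
  obtain ⟨a, ha, h1, h2⟩ := exists_first_gap hlast
  obtain ⟨v, hv⟩ := eq_replicate_append_of_mem (a := a) hy1.2 (by simp; omega) h1 h2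
  have hpos := hν.pos _ ⟨y, hy⟩
  have hpos' := hν.pos _ ⟨_, hy1.2⟩
  obtain ⟨τ, hτ⟩ := hν.renewal
  have h3 : wordMass ν (w ++ [0]) = gapMass ν a * τ v := by rw [hv, hτ]; rfl
  have h4 : wordMass ν (1 :: (w ++ [0])) = gapMass ν (a + 1) * τ v := by
    rw [hv, ← List.cons_append, ← List.replicate_succ, hτ]; rfl
  have h5 : wordMass ν (1 :: (w ++ [0])) = gapRatio ν a * wordMass ν (w ++ [0]) := by
    have := hν.gapMass_pos a
    rw [h3, h4, gapRatio]; field_simp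
  have h6 : wordMass ν (b :: (w ++ [0]))
      = symbolProb (gapRatio ν) lam y * wordMass ν (w ++ [0]) := by
    rw [symbolProb, gapFun_eq h1 h2, hy1.1]
    split_ifs with hb
    · rw [hb, h5]
    · rw [fin_two_eq_zero_of_ne hb]
      have := hν.sum_cons (w ++ [0])
      linarith
  refine ⟨?_, h6⟩
  rw [h6] at hpos
  exact pos_of_mul_pos_left hpos hpos'.le

theorem wordMass_append (hν : IsRenewal ν) {lam : ℝ} {y : SFT B} {u w : List (Fin 2)}
    (hy : y ∈ wordCyl B (u ++ (w ++ [0]))) :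
    wordMass ν (u ++ (w ++ [0])) = Real.exp (birkhoffSum (shift B)
      (fun z => Real.log (symbolProb (gapRatio ν) lam z)) u.length y) * wordMass ν (w ++ [0]) := by
  induction u generalizing y with
  | nil => simp
  | cons b u ih =>
    have h1 := ih (mem_wordCyl_cons.1 hy).2
    rw [List.cons_append, ← List.append_assoc] at hy ⊢
    obtain ⟨h2, h3⟩ := hν.wordMass_cons (lam := lam) hy
    rw [h3, List.append_assoc, h1, List.length_cons, birkhoffSum_succ', Real.exp_add,
      Real.exp_log h2, mul_assoc]

theorem birkhoffSum_of_forall {θ : ℕ → ℝ} {lam : ℝ} {y : SFT B} (hy : ∀ i, y.1 i = 1) (n : ℕ) :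
    birkhoffSum (shift B) (fun z => Real.log (symbolProb θ lam z)) n y = n * Real.log lam := by
  induction n generalizing y with
  | zero => simp
  | succ n ih =>
    rw [birkhoffSum_succ', ih (y := shift B y) fun i => hy (i + 1), symbolProb, if_pos (hy 0),
      gapFun_eq_of_forall fun a => by rw [hy]; exact one_ne_zero]
    push_cast; ring

theorem log_wordMass_append (hν : IsRenewal ν) {c : ℕ → ℝ}
    (hadd : ∀ (y : SFT B) (n m : ℕ), 1 ≤ n → 1 ≤ m →
      AdditivityBound (fun n y => wordMass ν (initWord n y)) (c n) n m y)
    {u v : List (Fin 2)} (huv : (wordCyl B (u ++ v)).Nonempty) (hu : 1 ≤ u.length)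
    (hv : 1 ≤ v.length) :
    |Real.log (wordMass ν (u ++ v)) - Real.log (wordMass ν u) - Real.log (wordMass ν v)|
      ≤ c u.length := by
  obtain ⟨y, hy⟩ := huv
  have h1 := mem_wordCyl_append.1 hy
  have hu0 := hν.pos _ ⟨y, h1.1⟩
  have hv0 := hν.pos _ ⟨_, h1.2⟩
  have huv0 := hν.pos _ ⟨y, hy⟩
  have h := hadd y u.length v.length hu hv
  rw [AdditivityBound, ← List.length_append, initWord_eq_of_mem hy, initWord_eq_of_mem h1.1,
    initWord_eq_of_mem h1.2] at h
  have h2 := Real.log_le_log huv0 h.1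
  have h3 := Real.log_le_log (by positivity) h.2
  rw [Real.log_mul (by positivity) (by positivity), Real.log_mul (by positivity) (by positivity),
    Real.log_exp] at h2 h3
  rw [abs_le]
  constructor <;> linarith

theorem replicate_nonempty (hν : IsRenewal ν) (n : ℕ) :
    (wordCyl B (List.replicate n 1)).Nonempty :=
  (hν.nonempty n).mono fun _ hx => (mem_wordCyl_append.1 hx).1

/-- The exponential rate of the mass of `1 ⋯ 1`. -/
theorem exists_log_rate (hν : IsRenewal ν) {c : ℕ → ℝ}
    (hadd : ∀ (y : SFT B) (n m : ℕ), 1 ≤ n → 1 ≤ m →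
      AdditivityBound (fun n y => wordMass ν (initWord n y)) (c n) n m y)
    (hc : Tendsto (fun n : ℕ => c n / n) atTop (𝓝 0)) :
    ∃ ℓ < 0, ∀ n : ℕ, 1 ≤ n → |Real.log (wordMass ν (List.replicate n 1)) - n * ℓ| ≤ c n := by
  obtain ⟨ℓ, hℓ⟩ := exists_rate (a := fun n => Real.log (wordMass ν (List.replicate n 1)))
    (c := c) (fun n m hn hm => by
      have := hν.log_wordMass_append hadd (u := List.replicate n 1) (v := List.replicate m 1)
        (by rw [List.replicate_append_replicate]; exact hν.replicate_nonempty _)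
        (by simpa using hn) (by simpa using hm)
      rwa [List.replicate_append_replicate, List.length_replicate] at this) hc
  refine ⟨ℓ, ?_, hℓ⟩
  obtain ⟨K, d, hd, hK⟩ := hν.decay
  have hpos : ∀ n, 0 < wordMass ν (List.replicate n 1) := fun n => hν.pos _ (hν.replicate_nonempty n)
  have hK0 : 0 < K := pos_of_mul_pos_left ((hpos 0).trans_le (hK 0)) (Real.exp_pos _).le
  have h1 : ∀ n : ℕ, 1 ≤ n → ℓ ≤ Real.log K / n - d + c n / n := by
    intro n hn
    have hn' : (0 : ℝ) < n := by exact_mod_cast hn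
    have h2 := Real.log_le_log (hpos n) (hK n)
    rw [Real.log_mul hK0.ne' (Real.exp_pos _).ne', Real.log_exp] at h2
    have h3 := (abs_le.1 (hℓ n hn)).1
    have h4 : Real.log K / n - d + c n / n = (Real.log K - d * n + c n) / n := by field_simp
    rw [h4, le_div_iff₀ hn']
    linarith
  have h2 : Tendsto (fun n : ℕ => Real.log K / n - d + c n / n) atTop (𝓝 (0 - d + 0)) :=
    ((tendsto_const_div_atTop_nhds_zero_nat _).sub_const d).add hc
  have h3 : ℓ ≤ 0 - d + 0 := by
    refine ge_of_tendsto h2 ?_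
    filter_upwards [eventually_ge_atTop 1] with n hn using h1 n hn
  linarith

/-- The Gibbs inequality for the logarithm of `symbolProb`. If `y` has a `0` at or after position
`n`, the Birkhoff sum telescopes to a ratio of two cylinder masses; otherwise it telescopes up to
the last `0` of `y`, and the rest is `1 ⋯ 1`. -/
theorem exists_gibbsBound (hν : IsRenewal ν) {c : ℕ → ℝ} (hmono : Monotone c) (hc0 : ∀ n, 0 ≤ c n)
    (hadd : ∀ (y : SFT B) (n m : ℕ), 1 ≤ n → 1 ≤ m →
      AdditivityBound (fun n y => wordMass ν (initWord n y)) (c n) n m y)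
    {ℓ : ℝ} (hℓ : ∀ n : ℕ, 1 ≤ n →
      |Real.log (wordMass ν (List.replicate n 1)) - n * ℓ| ≤ c n) :
    ∃ K : ℝ, ∀ (y : SFT B) (n : ℕ), 1 ≤ n →
      GibbsBound ν (fun z => Real.log (symbolProb (gapRatio ν) (Real.exp ℓ) z)) 0
        (Real.exp (K + 2 * c n)) n y := by
  set g : SFT B → ℝ := fun z => Real.log (symbolProb (gapRatio ν) (Real.exp ℓ) z) with hg
  set K := |Real.log (wordMass ν [0])| + |Real.log (1 - Real.exp ℓ)| with hK
  have hK0 : 0 ≤ K := by positivity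
  refine ⟨K, fun y n hn => ?_⟩
  have hpos : 0 < wordMass ν (initWord n y) := hν.pos _ ⟨y, mem_wordCyl_initWord n y⟩
  suffices h : |Real.log (wordMass ν (initWord n y)) - birkhoffSum (shift B) g n y|
      ≤ K + 2 * c n by
    rw [abs_le] at h
    have h1 : wordMass ν (initWord n y) = Real.exp (Real.log (wordMass ν (initWord n y))) :=
      (Real.exp_log hpos).symm
    refine gibbsBound_of_le (Real.exp_pos _) ?_ ?_
    · rw [h1, ← Real.exp_add, Real.exp_le_exp]
      linarith
    · rw [h1, ← Real.exp_add, Real.exp_le_exp]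
      linarith
  by_cases htail : ∃ j, y.1 (n + j) = 0
  · obtain ⟨j, hj⟩ := htail
    have h1 := initWord_add n (j + 1) y
    rw [initWord_succ_right, shift_iterate_apply, hj] at h1
    have hmem : y ∈ wordCyl B (initWord n y ++ (initWord j ((shift B)^[n] y) ++ [0])) := by
      rw [← h1]; exact mem_wordCyl_initWord _ _
    have h2 := hν.wordMass_append (lam := Real.exp ℓ) hmem
    have hwpos := hν.pos _ ⟨_, (mem_wordCyl_append.1 hmem).2⟩
    have h3 := congrArg Real.log h2
    rw [Real.log_mul (Real.exp_pos _).ne' hwpos.ne', Real.log_exp, length_initWord] at h3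
    have h4 := hν.log_wordMass_append hadd ⟨y, hmem⟩ (by simpa using hn) (by simp)
    rw [length_initWord, h3] at h4
    rw [abs_le] at h4 ⊢
    have := hc0 n
    constructor <;> linarith [h4.1, h4.2]
  · push Not at htail
    by_cases hhead : ∃ i, y.1 i = 0
    · -- `m` is the position of the last `0` of `y`
      obtain ⟨m, hm0, hm1⟩ : ∃ m, y.1 m = 0 ∧ ∀ i, m < i → y.1 i ≠ 0 := by
        obtain ⟨i, hi⟩ := hhead
        have hlt : ∀ i, y.1 i = 0 → i ≤ n := by
          intro i hi
          by_contra hin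
          obtain ⟨j, rfl⟩ := Nat.exists_eq_add_of_le (not_le.1 hin).le
          exact htail j hi
        classical
        exact ⟨Nat.findGreatest (fun i => y.1 i = 0) n,
          Nat.findGreatest_spec (P := fun i => y.1 i = 0) (hlt i hi) hi, fun i hi hi0 =>
            Nat.findGreatest_is_greatest hi (hlt i hi0) hi0⟩
      have hmn : m < n := by
        by_contra hmn
        obtain ⟨j, rfl⟩ := Nat.exists_eq_add_of_le (not_lt.1 hmn)
        exact htail j hm0
      obtain ⟨b, rfl⟩ := Nat.exists_eq_add_of_le hmn
      rw [Nat.succ_eq_add_one] at hn hpos ⊢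
      have hones : ∀ i, ((shift B)^[m + 1] y).1 i = 1 := fun i => by
        rw [shift_iterate_apply]
        exact fin_two_eq_one_of_ne (hm1 _ (by omega))
      have hword : initWord (m + 1 + b) y = initWord m y ++ 0 :: List.replicate b 1 := by
        rw [initWord_add, initWord_succ_right, hm0, initWord_eq_replicate fun i _ => hones i]
        simp
      have hmem : y ∈ wordCyl B (initWord m y ++ ([] ++ [0])) := by
        have := mem_wordCyl_initWord (m + 1) y
        rwa [initWord_succ_right, hm0] at this
      have h2 := congrArg Real.log (hν.wordMass_append (lam := Real.exp ℓ) hmem)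
      rw [List.nil_append, Real.log_mul (Real.exp_pos _).ne' hν.wordMass_zero_pos.ne',
        Real.log_exp, length_initWord] at h2
      have hS : birkhoffSum (shift B) g (m + 1 + b) y
          = birkhoffSum (shift B) g m y + Real.log (1 - Real.exp ℓ) + b * ℓ := by
        rw [birkhoffSum_add, birkhoffSum_succ, hg, birkhoffSum_of_forall hones, Real.log_exp]
        congr 2
        simp only [symbolProb]
        rw [if_neg, gapFun_eq_of_forall]
        · intro a
          rw [shift_iterate_apply]
          exact hm1 _ (by omega)
        · rw [shift_iterate_apply, add_zero, hm0]; exact zero_ne_one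
      have hb0 : (wordCyl B ((0 : Fin 2) :: List.replicate b 1)).Nonempty := by
        have := mem_wordCyl_initWord (m + 1 + b) y
        rw [hword] at this
        exact ⟨_, (mem_wordCyl_append.1 this).2⟩
      have hN : Real.log (wordMass ν (initWord (m + 1 + b) y)) + Real.log (wordMass ν [0])
          = Real.log (wordMass ν (initWord m y ++ [0]))
            + Real.log (wordMass ν (0 :: List.replicate b 1)) := by
        rw [hword] at hpos ⊢
        rw [← Real.log_mul hpos.ne' hν.wordMass_zero_pos.ne', hν.wordMass_mul,
          Real.log_mul (hν.pos (initWord m y ++ [0]) ⟨y, hmem⟩).ne' (hν.pos _ hb0).ne']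
      have hb : |Real.log (wordMass ν (0 :: List.replicate b 1)) - b * ℓ|
          ≤ |Real.log (wordMass ν [0])| + 2 * c (m + 1 + b) := by
        have hcn := hc0 (m + 1 + b)
        rcases Nat.eq_zero_or_pos b with rfl | hb
        · simp only [List.replicate_zero, Nat.cast_zero, zero_mul, sub_zero]
          linarith
        · have h5 := hν.log_wordMass_append hadd (u := [0]) (v := List.replicate b 1) hb0
            (by simp) (by rw [List.length_replicate]; exact hb)
          have h6 := hℓ b hb
          have h7 : c [(0 : Fin 2)].length ≤ c (m + 1 + b) := hmono (by simp; omega)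
          have h8 : c b ≤ c (m + 1 + b) := hmono (by omega)
          rw [List.singleton_append] at h5
          have h9 := abs_le.1 (le_refl |Real.log (wordMass ν [0])|)
          rw [abs_le] at h5 h6 ⊢
          constructor <;> linarith [h5.1, h5.2, h6.1, h6.2, h9.1, h9.2]
      rw [hS]
      have h9 := abs_le.1 (le_refl |Real.log (1 - Real.exp ℓ)|)
      rw [abs_le] at hb ⊢
      constructor <;> linarith [hb.1, hb.2, h9.1, h9.2]
    · push Not at hhead
      have hones : ∀ i, y.1 i = 1 := fun i => fin_two_eq_one_of_ne (hhead i)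
      rw [hg, birkhoffSum_of_forall hones, Real.log_exp, initWord_eq_replicate fun i _ => hones i]
      refine (hℓ n hn).trans ?_
      linarith [hc0 n]

end IsRenewal

end Potential

/-! ### Uniqueness of weak Gibbs measures -/

section Uniqueness

section

variable {k : ℕ} {A : Matrix (Fin k) (Fin k) ℕ} {ν ν' : Measure (SFT A)} {g : SFT A → ℝ}

theorem wordMass_le_of_gibbsBound {P P' : ℝ} {C C' : ℕ → ℝ} (hC : ∀ n, 1 ≤ n → 0 < C n)
    (hC' : ∀ n, 1 ≤ n → 0 < C' n)
    (hb : ∀ (x : SFT A) (n : ℕ), 1 ≤ n → GibbsBound ν g P (C n) n x)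
    (hb' : ∀ (x : SFT A) (n : ℕ), 1 ≤ n → GibbsBound ν' g P' (C' n) n x)
    {w : List (Fin k)} (hw : 1 ≤ w.length) :
    wordMass ν' w ≤ Real.exp (Real.log (C w.length) + Real.log (C' w.length)
      + w.length * (P - P')) * wordMass ν w := by
  by_cases h : (wordCyl A w).Nonempty
  · obtain ⟨x, hx⟩ := h
    have h1 := (hb x _ hw).le_wordMass (hC _ hw)
    have h2 := (hb' x _ hw).wordMass_le
    rw [initWord_eq_of_mem hx] at h1 h2
    rw [Real.exp_add, Real.exp_add, Real.exp_log (hC _ hw), Real.exp_log (hC' _ hw)]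
    have h3 : Real.exp (-(w.length * P') + birkhoffSum (shift A) g w.length x)
        = Real.exp (w.length * (P - P')) *
          Real.exp (-(w.length * P) + birkhoffSum (shift A) g w.length x) := by
      rw [← Real.exp_add]; congr 1; ring
    rw [h3] at h2
    refine h2.trans ?_
    calc _ ≤ C' w.length * (Real.exp (w.length * (P - P')) * (C w.length * wordMass ν w)) :=
          mul_le_mul_of_nonneg_left (mul_le_mul_of_nonneg_left h1 (Real.exp_pos _).le)
            (hC' _ hw).le
      _ = _ := by ring
  · rw [wordMass_eq_zero h, wordMass_eq_zero h, mul_zero]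

theorem tendsto_log_add {C C' : ℕ → ℝ}
    (hC : Tendsto (fun n : ℕ => (1 / (n : ℝ)) * Real.log (C n)) atTop (𝓝 0))
    (hC' : Tendsto (fun n : ℕ => (1 / (n : ℝ)) * Real.log (C' n)) atTop (𝓝 0)) :
    Tendsto (fun n : ℕ => (Real.log (C n) + Real.log (C' n)) / n) atTop (𝓝 0) := by
  have := hC.add hC'
  rw [add_zero] at this
  exact this.congr fun n => by ring

theorem pressure_le (hν : IsInvariantProb ν) (hν' : IsInvariantProb ν') {P P' : ℝ} {C C' : ℕ → ℝ}
    (hC : ∀ n, 1 ≤ n → 0 < C n) (hC' : ∀ n, 1 ≤ n → 0 < C' n)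
    (hb : ∀ (x : SFT A) (n : ℕ), 1 ≤ n → GibbsBound ν g P (C n) n x)
    (hb' : ∀ (x : SFT A) (n : ℕ), 1 ≤ n → GibbsBound ν' g P' (C' n) n x)
    (hlim : Tendsto (fun n : ℕ => (Real.log (C n) + Real.log (C' n)) / n) atTop (𝓝 0)) :
    P' ≤ P := by
  have h1 : ∀ n : ℕ, 1 ≤ n → 0 ≤ (Real.log (C n) + Real.log (C' n)) / n + (P - P') := by
    intro n hn
    have h2 : wordSum n (wordMass ν')
        ≤ wordSum n fun w => wordMass ν w *
          Real.exp (Real.log (C n) + Real.log (C' n) + n * (P - P')) := by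
      refine wordSum_mono fun w hw => ?_
      subst hw
      rw [mul_comm]
      exact wordMass_le_of_gibbsBound hC hC' hb hb' hn
    have h3 : ∀ {κ : Measure (SFT A)}, IsInvariantProb κ → wordSum n (wordMass κ) = 1 := by
      intro κ hκ
      have := wordSum_right (sum_wordMass_append hκ) n []
      rwa [wordMass_nil hκ] at this
    rw [wordSum_mul_right, h3 hν, h3 hν', one_mul, Real.one_le_exp_iff] at h2
    have hn' : (0 : ℝ) < n := by exact_mod_cast hn
    rw [div_add' _ _ _ hn'.ne']
    exact div_nonneg (by linarith) hn'.le
  have h2 := hlim.add_const (P - P')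
  rw [zero_add] at h2
  have h3 := ge_of_tendsto h2 (by
    filter_upwards [eventually_ge_atTop 1] with n hn using h1 n hn)
  linarith

/-- Two weak Gibbs measures for the same function are subexponentially comparable. -/
theorem exists_comparable (hν : IsInvariantWeakGibbs ν g) (hν' : IsInvariantWeakGibbs ν' g) :
    ∃ c : ℕ → ℝ, Tendsto (fun n : ℕ => c n / n) atTop (𝓝 0) ∧
      ∀ w, wordMass ν' w ≤ Real.exp (c w.length) * wordMass ν w := by
  obtain ⟨h0, P, C, hC, hlim, hb⟩ := hν
  obtain ⟨h0', P', C', hC', hlim', hb'⟩ := hν'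
  have hP : P = P' := le_antisymm
    (pressure_le h0' h0 hC' hC hb' hb (tendsto_log_add hlim' hlim))
    (pressure_le h0 h0' hC hC' hb hb' (tendsto_log_add hlim hlim'))
  refine ⟨fun n => if n = 0 then 0 else Real.log (C n) + Real.log (C' n), ?_, fun w => ?_⟩
  · refine (tendsto_log_add hlim hlim').congr' ?_
    filter_upwards [eventually_gt_atTop 0] with n hn
    rw [if_neg hn.ne']
  · beta_reduce
    by_cases hw : w.length = 0
    · rw [if_pos hw, List.length_eq_zero_iff.1 hw, wordMass_nil h0, wordMass_nil h0']
      simp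
    · rw [if_neg hw]
      have := wordMass_le_of_gibbsBound hC hC' hb hb' (w := w) (by omega)
      rwa [hP, sub_self, mul_zero, add_zero] at this

end

variable {B : Matrix (Fin 2) (Fin 2) ℕ} {ν ν' : Measure (SFT B)} {g : SFT B → ℝ}

/-- A renewal measure that is weak Gibbs for `g` is the only one. Another weak Gibbs measure has
zero relative entropy per symbol, so it has the same conditional probabilities after each word
containing `0`; it is then proportional to the renewal measure on all words containing `0`, and
the mass of `1 ⋯ 1` tends to `0` for both. -/
theorem IsRenewal.eq_of_weakGibbs (hν : IsRenewal ν) (hg : IsInvariantWeakGibbs ν g)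
    (hg' : IsInvariantWeakGibbs ν' g) : ν' = ν := by
  obtain ⟨c, hc, hle⟩ := exists_comparable hg hg'
  have hν' := hg'.1
  set p := wordMass ν' with hp
  set q := wordMass ν with hq
  have hstep : ∀ v : List (Fin 2), ∃ t : Fin 2 → ℝ, ∀ a,
      p (0 :: v ++ [a]) = p (0 :: v) * t a ∧ q (0 :: v ++ [a]) = q (0 :: v) * t a := by
    intro v
    obtain ⟨τ, hτ⟩ := hν.renewal
    have hs : ∀ w a, q (w ++ (0 :: v) ++ [a]) = q (w ++ (0 :: v)) * (τ (v ++ [a]) / τ v) := by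
      intro w a
      have h1 := wordMass_append_le hν.inv (w ++ 0 :: v) [a]
      have h2 := wordMass_nonneg ν (w ++ 0 :: v ++ [a])
      have h3 : w ++ 0 :: v ++ [a] = w ++ 0 :: (v ++ [a]) := by simp
      have h4 := hτ w v
      have h5 := hτ w (v ++ [a])
      rw [h3] at h1 h2 ⊢
      by_cases h0 : τ v = 0
      · rw [h4, h0, mul_zero] at h1
        rw [hq, h4, h0, mul_zero, zero_mul]
        exact le_antisymm h1 h2
      · rw [hq, h4, h5]
        field_simp
    refine ⟨fun a => τ (v ++ [a]) / τ v, fun a => ⟨?_, by simpa using hs [] a⟩⟩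
    exact eq_mul_of_entropy (wordMass_nonneg ν') (wordMass_nonneg ν) (sum_wordMass_append hν')
      (sum_wordMass_cons hν') (sum_wordMass_append hν.inv) hc hle hs a
  have hzero : ∀ v, p (0 :: v) * q [0] = p [0] * q (0 :: v) := by
    intro v
    induction v using List.reverseRecOn with
    | nil => rfl
    | append_singleton v a ih =>
      obtain ⟨t, ht⟩ := hstep v
      rw [← List.cons_append, (ht a).1, (ht a).2]
      linear_combination t a * ih
  have hcons : ∀ {κ : Measure (SFT B)}, IsInvariantProb κ → ∀ w,
      wordMass κ (1 :: w) = wordMass κ w - wordMass κ (0 :: w) := by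
    intro κ hκ w
    rw [← sum_wordMass_cons hκ w, Fin.sum_univ_two]; ring
  have hmem : ∀ v : List (Fin 2), 0 ∈ v → p v * q [0] = p [0] * q v := by
    intro v
    induction v with
    | nil => simp
    | cons b v ih =>
      intro hv
      by_cases hb : b = 0
      · rw [hb]; exact hzero v
      · have h1 := ih ((List.mem_cons.1 hv).resolve_left (Ne.symm hb))
        rw [fin_two_eq_one_of_ne hb, hp, hq, hcons hν', hcons hν.inv]
        linear_combination h1 - hzero v
  have hones : ∀ n, p (List.replicate n 1) * q [0] - p [0] * q (List.replicate n 1)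
      = q [0] - p [0] := by
    intro n
    induction n with
    | zero => rw [List.replicate_zero, hp, hq, wordMass_nil hν', wordMass_nil hν.inv]; ring
    | succ n ih =>
      rw [← ih, List.replicate_succ]
      have h1 := hcons hν' (List.replicate n 1)
      have h2 := hcons hν.inv (List.replicate n 1)
      rw [← hp] at h1
      rw [← hq] at h2
      rw [h1, h2]
      linear_combination - hzero (List.replicate n 1)
  obtain ⟨K, d, hd, hK⟩ := hν.decay
  have hlin : Tendsto (fun n : ℕ => -(d / 2 * n)) atTop atBot :=
    tendsto_neg_atTop_atBot.comp
      (tendsto_natCast_atTop_atTop.const_mul_atTop (half_pos hd))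
  have hqlim : Tendsto (fun n => q (List.replicate n 1)) atTop (𝓝 0) := by
    have h1 : Tendsto (fun n : ℕ => K * Real.exp (-(d / 2 * n))) atTop (𝓝 (K * 0)) :=
      (Real.tendsto_exp_atBot.comp hlin).const_mul K
    rw [mul_zero] at h1
    have hK0 : 0 ≤ K := by
      have := (wordMass_nonneg ν _).trans (hK 0)
      simpa using this
    refine squeeze_zero (fun n => wordMass_nonneg ν _) (fun n => (hK n).trans ?_) h1
    refine mul_le_mul_of_nonneg_left (Real.exp_le_exp.2 ?_) hK0
    have : 0 ≤ d / 2 * n := by positivity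
    linarith
  have hplim : Tendsto (fun n => p (List.replicate n 1)) atTop (𝓝 0) := by
    have h1 : Tendsto (fun n : ℕ => K * Real.exp (-(d / 2 * n))) atTop (𝓝 (K * 0)) :=
      (Real.tendsto_exp_atBot.comp hlin).const_mul K
    rw [mul_zero] at h1
    have hK0 : 0 ≤ K := by
      have := (wordMass_nonneg ν _).trans (hK 0)
      simpa using this
    refine squeeze_zero' (Eventually.of_forall fun n => wordMass_nonneg ν' _) ?_ h1
    filter_upwards [eventually_gt_atTop 0, hc.eventually (gt_mem_nhds (half_pos hd))] with n hn hcn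
    have hn' : (0 : ℝ) < n := by exact_mod_cast hn
    rw [div_lt_iff₀ hn'] at hcn
    have h2 := hle (List.replicate n 1)
    rw [List.length_replicate] at h2
    refine h2.trans ((mul_le_mul_of_nonneg_left (hK n) (Real.exp_pos _).le).trans ?_)
    rw [mul_left_comm, ← Real.exp_add]
    refine mul_le_mul_of_nonneg_left (Real.exp_le_exp.2 ?_) hK0
    linarith
  have h00 : q [0] - p [0] = 0 := by
    have h1 := (hplim.mul_const (q [0])).sub (hqlim.const_mul (p [0]))
    rw [zero_mul, mul_zero, sub_zero] at h1
    simp only [hones] at h1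
    exact tendsto_nhds_unique tendsto_const_nhds h1
  have hq0 := hν.wordMass_zero_pos
  have h01 : p [0] = q [0] := by linarith
  refine eq_of_wordMass_eq hν' hν.inv fun w => ?_
  have key : p w * q [0] = q w * q [0] := by
    by_cases hw : (0 : Fin 2) ∈ w
    · rw [hmem w hw, h01, mul_comm]
    · have h1 : w = List.replicate w.length 1 :=
        List.eq_replicate_length.2 fun b hb => fin_two_eq_one_of_ne fun h => hw (h ▸ hb)
      have h2 := hones w.length
      rw [← h1, h00, h01] at h2
      linarith
  exact mul_right_cancel₀ hq0.ne' key

end Uniqueness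

/-! ### Regularity of the potential -/

section Regularity

variable {B : Matrix (Fin 2) (Fin 2) ℕ}

theorem continuous_of_forall_cyl {F : SFT B → ℝ} (N : ℕ)
    (h : ∀ y z : SFT B, (∀ i < N, z.1 i = y.1 i) → F z = F y) : Continuous F := by
  refine IsLocallyConstant.continuous ((IsLocallyConstant.iff_exists_open F).2 fun y => ?_)
  refine ⟨⋂ i ∈ Finset.range N, (fun z : SFT B => z.1 i) ⁻¹' {y.1 i},
    isOpen_biInter_finset fun i _ => ?_, by simp, fun z hz => h y z fun i hi => ?_⟩
  · exact (isOpen_discrete _).preimage ((continuous_apply i).comp continuous_subtype_val)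
  · simpa using Set.mem_iInter₂.1 hz i (Finset.mem_range.2 hi)

/-- Truncated to gaps shorter than `n`, the function `gapFun` depends on finitely many symbols. -/
theorem continuous_gapFun_truncate (θ : ℕ → ℝ) (lam : ℝ) (n : ℕ) :
    Continuous (gapFun (B := B) (fun a => if a < n then θ a else lam) lam) := by
  refine continuous_of_forall_cyl (n + 1) fun y z h => ?_
  have hlam : ∀ y : SFT B, (∀ a < n, y.1 (a + 1) ≠ 0) →
      gapFun (fun a => if a < n then θ a else lam) lam y = lam := by
    intro y hy
    by_cases hy' : ∃ b, y.1 (b + 1) = 0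
    · obtain ⟨b, hb⟩ := hy'
      obtain ⟨a, -, h1, h2⟩ := exists_first_gap hb
      rw [gapFun_eq h1 h2, if_neg fun han => hy a han h2]
    · push Not at hy'
      exact gapFun_eq_of_forall hy'
  by_cases hy : ∃ b < n, y.1 (b + 1) = 0
  · obtain ⟨b, hbn, hb⟩ := hy
    obtain ⟨a, hab, h1, h2⟩ := exists_first_gap hb
    rw [gapFun_eq h1 h2, gapFun_eq (a := a)]
    · intro i hi
      rw [h _ (by omega)]; exact h1 i hi
    · rw [h _ (by omega)]; exact h2
  · push Not at hy
    rw [hlam y hy, hlam z fun a ha => by rw [h _ (by omega)]; exact hy a ha]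

theorem gapFun_truncate_cases (θ : ℕ → ℝ) (lam : ℝ) (y : SFT B) :
    (∀ n, gapFun (fun a => if a < n then θ a else lam) lam y = gapFun θ lam y) ∨
    ∃ a, gapFun θ lam y = θ a ∧
      ∀ n, gapFun (fun a => if a < n then θ a else lam) lam y = if a < n then θ a else lam := by
  by_cases hy : ∃ b, y.1 (b + 1) = 0
  · obtain ⟨b, hb⟩ := hy
    obtain ⟨a, -, h1, h2⟩ := exists_first_gap hb
    exact Or.inr ⟨a, gapFun_eq h1 h2, fun n => gapFun_eq h1 h2⟩
  · push Not at hy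
    exact Or.inl fun n => by rw [gapFun_eq_of_forall hy, gapFun_eq_of_forall hy]

theorem measurable_gapFun (θ : ℕ → ℝ) (lam : ℝ) : Measurable (gapFun (B := B) θ lam) := by
  refine measurable_of_tendsto_metrizable
    (fun n => (continuous_gapFun_truncate (B := B) θ lam n).measurable)
    (tendsto_pi_nhds.2 fun y => ?_)
  rcases gapFun_truncate_cases θ lam y with h | ⟨a, h1, h2⟩
  · simp only [h]; exact tendsto_const_nhds
  · refine tendsto_const_nhds.congr' ?_
    filter_upwards [eventually_gt_atTop a] with n hn
    rw [h2, h1, if_pos hn]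

theorem continuous_gapFun {θ : ℕ → ℝ} {lam : ℝ} (hθ : Tendsto θ atTop (𝓝 lam)) :
    Continuous (gapFun (B := B) θ lam) := by
  refine TendstoUniformly.continuous (p := atTop) (Metric.tendstoUniformly_iff.2 fun ε hε => ?_)
    (Frequently.of_forall fun n => continuous_gapFun_truncate (B := B) θ lam n)
  obtain ⟨N, hN⟩ := Metric.tendsto_atTop.1 hθ ε hε
  filter_upwards [eventually_ge_atTop N] with n hn y
  rcases gapFun_truncate_cases θ lam y with h | ⟨a, h1, h2⟩
  · rw [h, dist_self]; exact hε
  · rw [h1, h2]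
    split_ifs with ha
    · rw [dist_self]; exact hε
    · exact hN a (by omega)

theorem measurable_symbolProb (θ : ℕ → ℝ) (lam : ℝ) : Measurable (symbolProb (B := B) θ lam) :=
  Measurable.ite (measurable_coord 0 (measurableSet_singleton 1)) (measurable_gapFun θ lam)
    ((measurable_gapFun θ lam).const_sub 1)

theorem continuous_symbolProb {θ : ℕ → ℝ} {lam : ℝ} (hθ : Tendsto θ atTop (𝓝 lam)) :
    Continuous (symbolProb (B := B) θ lam) := by
  have h1 : Continuous fun y : SFT B => if y.1 0 = 1 then (1 : ℝ) else 0 :=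
    continuous_of_forall_cyl 1 fun y z h => by rw [h 0 one_pos]
  have h2 := continuous_gapFun (B := B) hθ
  refine ((h1.mul h2).add ((continuous_const (y := (1 : ℝ)).sub h1).mul
    (continuous_const (y := (1 : ℝ)).sub h2))).congr fun y => ?_
  by_cases hy : y.1 0 = 1 <;> simp [symbolProb, hy]

namespace IsRenewal

variable {ν : Measure (SFT B)}

theorem symbolProb_pos (hν : IsRenewal ν) {lam : ℝ} (h0 : 0 < lam) (h1 : lam < 1) (y : SFT B) :
    0 < symbolProb (gapRatio ν) lam y := by
  by_cases hy : ∃ b, y.1 (b + 1) = 0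
  · obtain ⟨b, hb⟩ := hy
    have hmem := mem_wordCyl_initWord (b + 2) y
    rw [initWord, initWord_succ_right] at hmem
    have h3 : (shift B y).1 b = 0 := hb
    rw [h3] at hmem
    exact (hν.wordMass_cons hmem).1
  · push Not at hy
    rw [symbolProb, gapFun_eq_of_forall hy]
    split_ifs
    · exact h0
    · linarith

/-- If the gap ratios converge, their limit is the exponential rate of the mass of `1 ⋯ 1`. -/
theorem gapRatio_limit (hν : IsRenewal ν) {c : ℕ → ℝ}
    (hadd : ∀ (y : SFT B) (n m : ℕ), 1 ≤ n → 1 ≤ m →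
      AdditivityBound (fun n y => wordMass ν (initWord n y)) (c n) n m y)
    (hc : Tendsto (fun n : ℕ => c n / n) atTop (𝓝 0)) {ℓ ρ : ℝ}
    (hℓ : ∀ n : ℕ, 1 ≤ n → |Real.log (wordMass ν (List.replicate n 1)) - n * ℓ| ≤ c n)
    (hρ : 0 < ρ) (hlim : Tendsto (gapRatio ν) atTop (𝓝 ρ)) : ρ = Real.exp ℓ := by
  have h1 : ∀ n, ∑ i ∈ Finset.range n, Real.log (gapRatio ν i)
      = Real.log (gapMass ν n) - Real.log (gapMass ν 0) := by
    intro n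
    rw [← Finset.sum_range_sub fun i => Real.log (gapMass ν i)]
    refine Finset.sum_congr rfl fun i _ => ?_
    rw [gapRatio, Real.log_div (hν.gapMass_pos _).ne' (hν.gapMass_pos _).ne']
  have h2 : Tendsto (fun n : ℕ => (n : ℝ)⁻¹ * ∑ i ∈ Finset.range n, Real.log (gapRatio ν i))
      atTop (𝓝 (Real.log ρ)) := (hlim.log hρ.ne').cesaro
  have h3 : Tendsto (fun n : ℕ => (n : ℝ)⁻¹ * ∑ i ∈ Finset.range n, Real.log (gapRatio ν i))
      atTop (𝓝 ℓ) := by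
    have hz : gapMass ν 0 = wordMass ν [0] := rfl
    rw [tendsto_iff_norm_sub_tendsto_zero]
    have h4 : Tendsto (fun n : ℕ => c n / n + c n / n) atTop (𝓝 0) := by
      simpa using hc.add hc
    refine squeeze_zero' (Eventually.of_forall fun n => norm_nonneg _) ?_ h4
    filter_upwards [eventually_ge_atTop 1] with n hn
    have hn' : (0 : ℝ) < n := by exact_mod_cast hn
    have h5 := hν.log_wordMass_append hadd (u := List.replicate n 1) (v := [0]) (hν.nonempty n)
      (by simpa using hn) (by simp)
    rw [List.length_replicate] at h5
    have h6 := hℓ n hn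
    rw [h1, hz, gapMass, Real.norm_eq_abs, ← add_div, le_div_iff₀ hn', ← abs_of_pos hn', ← abs_mul,
      abs_of_pos hn']
    have h7 : ((n : ℝ)⁻¹ * (Real.log (wordMass ν (List.replicate n 1 ++ [0]))
        - Real.log (wordMass ν [0])) - ℓ) * n
        = (Real.log (wordMass ν (List.replicate n 1 ++ [0]))
        - Real.log (wordMass ν [0])) - n * ℓ := by field_simp
    rw [h7]
    rw [abs_le] at *
    constructor <;> linarith [h5.1, h5.2, h6.1, h6.2]
  rw [← tendsto_nhds_unique h2 h3, Real.exp_log hρ]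

/-- A renewal measure with additive cylinder masses, up to a monotone sublinear error, satisfies
the Gibbs inequality for a measurable potential, continuous if the gap ratios converge. -/
theorem exists_potential (hν : IsRenewal ν) {c : ℕ → ℝ} (hmono : Monotone c) (hc0 : ∀ n, 0 ≤ c n)
    (hc : Tendsto (fun n : ℕ => c n / n) atTop (𝓝 0))
    (hadd : ∀ (y : SFT B) (n m : ℕ), 1 ≤ n → 1 ≤ m →
      AdditivityBound (fun n y => wordMass ν (initWord n y)) (c n) n m y) :
    ∃ (g : SFT B → ℝ) (K : ℝ), Measurable g ∧
      ((∃ ρ > 0, Tendsto (gapRatio ν) atTop (𝓝 ρ)) → Continuous g) ∧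
      ∀ (y : SFT B) (n : ℕ), 1 ≤ n → GibbsBound ν g 0 (Real.exp (K + 2 * c n)) n y := by
  obtain ⟨ℓ, hℓ0, hℓ⟩ := hν.exists_log_rate hadd hc
  obtain ⟨K, hK⟩ := hν.exists_gibbsBound hmono hc0 hadd hℓ
  refine ⟨_, K, (measurable_symbolProb (gapRatio ν) (Real.exp ℓ)).log, ?_, hK⟩
  rintro ⟨ρ, hρ, hlim⟩
  rw [hν.gapRatio_limit hadd hc hℓ hρ hlim] at hlim
  exact (continuous_symbolProb hlim).log fun y =>
    (hν.symbolProb_pos (Real.exp_pos ℓ) (Real.exp_zero ▸ Real.exp_lt_exp.2 hℓ0) y).ne'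

theorem exists_unique_gibbs (hν : IsRenewal ν) {c : ℝ} (hc0 : 0 ≤ c)
    (hadd : ∀ (y : SFT B) (n m : ℕ), 1 ≤ n → 1 ≤ m →
      AdditivityBound (fun n y => wordMass ν (initWord n y)) c n m y) :
    ∃ g : SFT B → ℝ, Measurable g ∧
      ((∃ ρ > 0, Tendsto (gapRatio ν) atTop (𝓝 ρ)) → Continuous g) ∧
      IsUniqueInvariantGibbs ν g := by
  obtain ⟨g, K, hg1, hg2, hg3⟩ := hν.exists_potential (c := fun _ => c) monotone_const
    (fun _ => hc0) (tendsto_const_div_atTop_nhds_zero_nat c) hadd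
  have h : IsInvariantGibbs ν g := ⟨hν.inv, 0, _, Real.exp_pos _, hg3⟩
  exact ⟨g, hg1, hg2, h, fun ν' hν' => hν.eq_of_weakGibbs h.weak hν'.weak⟩

theorem exists_unique_weakGibbs (hν : IsRenewal ν) {c : ℕ → ℝ}
    (hc : Tendsto (fun n : ℕ => c n / n) atTop (𝓝 0))
    (hadd : ∀ (y : SFT B) (n m : ℕ), 1 ≤ n → 1 ≤ m →
      AdditivityBound (fun n y => wordMass ν (initWord n y)) (c n) n m y) :
    ∃ g : SFT B → ℝ, Measurable g ∧
      ((∃ ρ > 0, Tendsto (gapRatio ν) atTop (𝓝 ρ)) → Continuous g) ∧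
      IsUniqueInvariantWeakGibbs ν g := by
  obtain ⟨c', hmono, hc'0, hcc', hc'⟩ := exists_monotone_majorant hc
  obtain ⟨g, K, hg1, hg2, hg3⟩ := hν.exists_potential hmono hc'0 hc' fun y n m hn hm => by
    have h := hadd y n m hn hm
    have hab : 0 ≤ wordMass ν (initWord n y) * wordMass ν (initWord m ((shift B)^[n] y)) :=
      mul_nonneg (wordMass_nonneg _ _) (wordMass_nonneg _ _)
    refine ⟨h.1.trans ?_, le_trans ?_ h.2⟩
    · simp only [mul_assoc]
      exact mul_le_mul_of_nonneg_right (Real.exp_le_exp.2 (hcc' n)) hab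
    · simp only [mul_assoc]
      exact mul_le_mul_of_nonneg_right (Real.exp_le_exp.2 (neg_le_neg (hcc' n))) hab
  have h : IsInvariantWeakGibbs ν g := by
    refine ⟨hν.inv, 0, _, fun n _ => Real.exp_pos _, ?_, hg3⟩
    have h1 := (tendsto_const_div_atTop_nhds_zero_nat K).add (hc'.const_mul 2)
    rw [mul_zero, add_zero] at h1
    refine h1.congr fun n => ?_
    rw [Real.log_exp]; ring
  exact ⟨g, hg1, hg2, h, fun ν' hν' => hν.eq_of_weakGibbs h hν'⟩

end IsRenewal

end Regularity

/-! ### Convergence of the gap ratios -/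

section GapRatios

/-- Positive bounded orbits of `s ↦ T - D / s` with `T > 0` converge to a positive limit. These are
the ratios of consecutive terms of a solution of a linear recurrence of order two. -/
theorem exists_limit_of_moebius {s : ℕ → ℝ} {T D : ℝ} (hT : 0 < T) (h0 : ∀ n, 0 < s n)
    (h1 : ∀ n, s n ≤ 1) (hs : ∀ n, s (n + 1) = T - D / s n) :
    ∃ ρ > 0, Tendsto s atTop (𝓝 ρ) := by
  rcases lt_trichotomy D 0 with hD | rfl | hD
  · -- With fixed points `L > 0` and `-m < 0`, the map is multiplication by `-m / L` in the
    -- coordinate `(s - L) / (s + m)`.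
    obtain ⟨L, m, hm, hL, hLT, hLm⟩ : ∃ L m : ℝ, 0 < m ∧ m < L ∧ L - m = T ∧ L * m = -D := by
      have h2 : 0 < T ^ 2 - 4 * D := by nlinarith [sq_nonneg T]
      have h3 : T < √(T ^ 2 - 4 * D) := Real.lt_sqrt_of_sq_lt (by linarith)
      have h4 := Real.sq_sqrt h2.le
      refine ⟨(√(T ^ 2 - 4 * D) + T) / 2, (√(T ^ 2 - 4 * D) - T) / 2, by linarith, by linarith,
        by ring, ?_⟩
      linear_combination h4 / 4
    have hL0 : 0 < L := hm.trans hL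
    have hz : ∀ n, (s n - L) / (s n + m) = (-(m / L)) ^ n * ((s 0 - L) / (s 0 + m)) := by
      intro n
      induction n with
      | zero => simp
      | succ n ih =>
        have hp := h0 n
        have h2 : s (n + 1) - L = -m * (s n - L) / s n := by
          rw [hs, eq_div_iff hp.ne']
          field_simp
          linear_combination (-s n) * hLT - hLm
        have h3 : s (n + 1) + m = L * (s n + m) / s n := by
          rw [hs, eq_div_iff hp.ne']
          field_simp
          linear_combination (-s n) * hLT - hLm
        have h4 : (0 : ℝ) < s n + m := by linarith
        rw [pow_succ', mul_assoc, ← ih, h2, h3]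
        field_simp
    have hlim : Tendsto (fun n => (s n - L) / (s n + m)) atTop (𝓝 0) := by
      have h2 : |-(m / L)| < 1 := by
        rw [abs_neg, abs_of_pos (div_pos hm hL0), div_lt_one hL0]; exact hL
      have h3 := (tendsto_pow_atTop_nhds_zero_of_abs_lt_one h2).mul_const
        ((s 0 - L) / (s 0 + m))
      rw [zero_mul] at h3
      exact h3.congr fun n => (hz n).symm
    refine ⟨L, hL0, ?_⟩
    rw [tendsto_iff_norm_sub_tendsto_zero]
    have hbound : Tendsto (fun n => |(s n - L) / (s n + m)| * (1 + m)) atTop (𝓝 0) := by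
      simpa using hlim.abs.mul_const (1 + m)
    refine squeeze_zero (fun n => norm_nonneg _) (fun n => ?_) hbound
    have h4 : (0 : ℝ) < s n + m := by linarith [h0 n]
    rw [Real.norm_eq_abs, abs_div, abs_of_pos h4, div_mul_eq_mul_div, le_div_iff₀ h4]
    exact mul_le_mul_of_nonneg_left (by linarith [h1 n]) (abs_nonneg _)
  · refine ⟨T, hT, (tendsto_add_atTop_iff_nat 1).1 ?_⟩
    refine tendsto_const_nhds.congr fun n => ?_
    rw [hs, zero_div, sub_zero]
  · have hdiff : ∀ n, (s n ≤ s (n + 1) → s (n + 1) ≤ s (n + 2)) ∧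
        (s (n + 1) ≤ s n → s (n + 2) ≤ s (n + 1)) := by
      intro n
      constructor <;> intro h <;> rw [hs (n + 1), hs n] <;>
        refine sub_le_sub_left ?_ T <;> rw [← hs n]
      · exact div_le_div_of_nonneg_left hD.le (h0 n) h
      · exact div_le_div_of_nonneg_left hD.le (h0 (n + 1)) h
    have hconv : ∃ ρ, Tendsto s atTop (𝓝 ρ) := by
      rcases le_total (s 0) (s 1) with h | h
      · have hmono : Monotone s := monotone_nat_of_le_succ fun n => by
          induction n with
          | zero => exact h
          | succ n ih => exact (hdiff n).1 ih
        exact ⟨_, tendsto_atTop_ciSup hmono ⟨1, by rintro _ ⟨n, rfl⟩; exact h1 n⟩⟩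
      · have hanti : Antitone s := antitone_nat_of_succ_le fun n => by
          induction n with
          | zero => exact h
          | succ n ih => exact (hdiff n).2 ih
        exact ⟨_, tendsto_atTop_ciInf hanti ⟨0, by rintro _ ⟨n, rfl⟩; exact (h0 n).le⟩⟩
    obtain ⟨ρ, hρ⟩ := hconv
    refine ⟨ρ, lt_of_le_of_ne (ge_of_tendsto' hρ fun n => (h0 n).le) ?_, hρ⟩
    rintro rfl
    have h2 : ∀ n, s (n + 1) * s n = T * s n - D := by
      intro n
      have := h0 n
      rw [hs]; field_simp
    have h3 := ((tendsto_add_atTop_iff_nat 1).2 hρ).mul hρ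
    simp only [h2] at h3
    have h4 := tendsto_nhds_unique h3 ((hρ.const_mul T).sub_const D)
    simp only [mul_zero, zero_sub] at h4
    linarith

theorem subM22_eq {A : Matrix (Fin 3) (Fin 3) ℕ} (f : SFT A → ℝ) :
    subM22 f = !![pairMatrix f 1 1, pairMatrix f 1 2; pairMatrix f 2 1, pairMatrix f 2 2] := by
  ext i j
  have h : ∀ a b : Fin 3, a ≠ 0 → b ≠ 0 → blockMatrix code f 1 1 a b = pairMatrix f a b := by
    intro a b ha hb
    have hc : ∀ a : Fin 3, a ≠ 0 → code a = 1 := fun a ha => by fin_cases a <;> simp_all [code]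
    simp only [blockMatrix, pairMatrix, Matrix.of_apply]
    by_cases hl : [a, b] ∈ language (SFT A)
    · rw [if_pos ⟨hl, hc a ha, hc b hb⟩, if_pos hl]
    · rw [if_neg fun h => hl h.1, if_neg hl]
  fin_cases i <;> fin_cases j <;> exact h _ _ (by decide) (by decide)

variable {A : Matrix (Fin 3) (Fin 3) ℕ} {B : Matrix (Fin 2) (Fin 2) ℕ} {π : SFT A → SFT B}
  {μ : Measure (SFT A)} {f : SFT A → ℝ} {t : Fin 3 → Fin 3 → ℝ}

theorem IsOneBlockFactorMap.gapMass_succ (hπ : IsOneBlockFactorMap code π)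
    (hμ : IsInvariantProb μ)
    (ht : ∀ u i j, wordMass μ (u ++ [i] ++ [j]) = wordMass μ (u ++ [i]) * t i j) (a : ℕ) :
    gapMass (μ.map π) (a + 1) = wordMass μ [1] * fiberProb t 1 (List.replicate a 1 ++ [0])
      + wordMass μ [2] * fiberProb t 2 (List.replicate a 1 ++ [0]) :=
  hπ.wordMass_map_one_cons hμ ht _

theorem fiberProb_replicate_succ (i : Fin 3) (a : ℕ) :
    fiberProb t i (List.replicate (a + 1) 1 ++ [0])
      = t i 1 * fiberProb t 1 (List.replicate a 1 ++ [0])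
        + t i 2 * fiberProb t 2 (List.replicate a 1 ++ [0]) :=
  fiberProb_one_cons i _

/-- The Cayley–Hamilton recurrence for the transition matrix restricted to the symbols over `1`. -/
theorem IsOneBlockFactorMap.gapMass_recurrence (hπ : IsOneBlockFactorMap code π)
    (hμ : IsInvariantProb μ)
    (ht : ∀ u i j, wordMass μ (u ++ [i] ++ [j]) = wordMass μ (u ++ [i]) * t i j) (a : ℕ) :
    gapMass (μ.map π) (a + 3) = (t 1 1 + t 2 2) * gapMass (μ.map π) (a + 2)
      - (t 1 1 * t 2 2 - t 1 2 * t 2 1) * gapMass (μ.map π) (a + 1) := by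
  rw [hπ.gapMass_succ hμ ht, hπ.gapMass_succ hμ ht, hπ.gapMass_succ hμ ht]
  simp only [fiberProb_replicate_succ]
  ring

theorem IsRenewal.exists_limit_of_geometric {ν : Measure (SFT B)} (hν : IsRenewal ν) {b : ℝ}
    (h : ∀ a, gapMass ν (a + 2) = b * gapMass ν (a + 1)) :
    ∃ ρ > 0, Tendsto (gapRatio ν) atTop (𝓝 ρ) := by
  have h1 : ∀ a, gapRatio ν (a + 1) = b := fun a => by
    rw [gapRatio, h, mul_div_cancel_right₀ _ (hν.gapMass_pos _).ne']
  refine ⟨b, ?_, (tendsto_add_atTop_iff_nat 1).1 (tendsto_const_nhds.congr fun a => (h1 a).symm)⟩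
  rw [← h1 0]; exact hν.gapRatio_pos _

theorem IsOneBlockFactorMap.isRenewal (hπ : IsOneBlockFactorMap code π)
    (hB : B = !![1, 1; 1, 1] ∨ B = !![0, 1; 1, 1]) (hirr : IsIrreducibleShift (SFT A))
    (hf : IsTwoCoordinate f) (hμ : IsInvariantGibbs μ f) : IsRenewal (μ.map π) := by
  obtain ⟨c, r, t, hc, hrpos, hr0, hr, htr, ht⟩ := exists_transition hf hμ
  have hpos : ∀ w, (wordCyl A w).Nonempty → 0 < wordMass μ w := fun w hw => hμ.weak.wordMass_pos hw
  refine ⟨hπ.isInvariantProb_map hμ.1, fun v hv => hπ.wordMass_map_pos hμ.1 hpos hv,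
    wordCyl_replicate_nonempty hB, ⟨fiberProb t 0, hπ.wordMass_map_renewal hμ.1 ht⟩,
    hπ.exists_decay hB hirr hμ.1 hpos (fun i j => ?_) (fun i => ?_) (fun i j hi => ?_) ht⟩
  · rw [htr]
    exact div_nonneg (mul_nonneg (mul_nonneg hc.le (pairMatrix_nonneg f i j)) (hr0 j)) (hr0 i)
  · simp only [htr]
    rw [← Finset.sum_div, hr]
    exact div_self_le_one _
  · have h0 : pairMatrix f i j = 0 := by
      by_contra h
      exact hi ((wordCyl_pair_nonempty h).mono fun x hx =>
        mem_wordCyl_cons.2 ⟨(mem_wordCyl_cons.1 hx).1, by simp⟩)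
    rw [htr, h0]; simp

/-- If `subM22 f` had zero trace without being antidiagonal with positive entries, its square would
vanish, and so would the gap masses; hence the trace is positive and the gap ratios converge. -/
theorem IsOneBlockFactorMap.exists_limit_of_not_antidiagonal (hπ : IsOneBlockFactorMap code π)
    (hf : IsTwoCoordinate f) (hμ : IsInvariantGibbs μ f) (hν : IsRenewal (μ.map π))
    (h : ¬ ∃ a₁ a₂ : ℝ, 0 < a₁ ∧ 0 < a₂ ∧ subM22 f = !![0, a₁; a₂, 0]) :
    ∃ ρ > 0, Tendsto (gapRatio (μ.map π)) atTop (𝓝 ρ) := by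
  obtain ⟨c, r, t, hc, hrpos, hr0, hr, htr, ht⟩ := exists_transition hf hμ
  have ht0 : ∀ i j, 0 ≤ t i j := fun i j => by
    rw [htr]
    exact div_nonneg (mul_nonneg (mul_nonneg hc.le (pairMatrix_nonneg f i j)) (hr0 j)) (hr0 i)
  have hrec := hπ.gapMass_recurrence hμ.1 ht
  have hdiag : ∀ i, t i i = 0 → pairMatrix f i i = 0 := by
    intro i hi
    by_contra h0
    obtain ⟨x, hx⟩ := wordCyl_pair_nonempty h0
    have hri := hrpos x
    rw [(mem_wordCyl_cons.1 hx).1] at hri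
    rw [htr, mul_div_cancel_right₀ _ hri.ne'] at hi
    exact (mul_ne_zero hc.ne' h0) hi
  have hT : 0 < t 1 1 + t 2 2 := by
    refine lt_of_le_of_ne (add_nonneg (ht0 _ _) (ht0 _ _)) fun hT => h ?_
    have h11 : t 1 1 = 0 := by linarith [ht0 1 1, ht0 2 2]
    have h22 : t 2 2 = 0 := by linarith [ht0 1 1, ht0 2 2]
    have h3 := hrec 0
    rw [h11, h22] at h3
    have h4 : t 1 2 * t 2 1 ≠ 0 := by
      intro h0
      rw [h0] at h3
      have := hν.gapMass_pos (0 + 3)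
      rw [h3] at this
      simp at this
    have hM : ∀ i j, t i j ≠ 0 → 0 < pairMatrix f i j := fun i j hij =>
      lt_of_le_of_ne (pairMatrix_nonneg f i j) fun h0 => hij (by rw [htr, ← h0]; simp)
    refine ⟨_, _, hM 1 2 (left_ne_zero_of_mul h4), hM 2 1 (right_ne_zero_of_mul h4), ?_⟩
    rw [subM22_eq, hdiag 1 h11, hdiag 2 h22]
  obtain ⟨ρ, hρ, hlim⟩ := exists_limit_of_moebius (s := fun a => gapRatio (μ.map π) (a + 1)) hT
    (fun a => hν.gapRatio_pos _) (fun a => hν.gapRatio_le_one _)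
    (D := t 1 1 * t 2 2 - t 1 2 * t 2 1) fun a => by
      have h1 := hν.gapMass_pos (a + 1)
      have h2 := hν.gapMass_pos (a + 1 + 1)
      simp only [gapRatio]
      rw [hrec a]
      field_simp
  exact ⟨ρ, hρ, (tendsto_add_atTop_iff_nat 1).1 hlim⟩

/-- If `subM22 f` is a multiple of the transposition of the two symbols over `1`, and this
transposition also fixes the transitions into `0`, or those out of `0`, then the right, or left,
eigenvector is fixed as well and the gap masses form a geometric sequence. -/
theorem IsOneBlockFactorMap.exists_limit_of_symmetric (hπ : IsOneBlockFactorMap code π)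
    (hf : IsTwoCoordinate f) (hμ : IsInvariantGibbs μ f) (hν : IsRenewal (μ.map π))
    {a₁ : ℝ} (ha : 0 < a₁) (hM : subM22 f = !![0, a₁; a₁, 0])
    (hsym : pairMatrix f 1 0 = pairMatrix f 2 0 ∨ pairMatrix f 0 1 = pairMatrix f 0 2) :
    ∃ ρ > 0, Tendsto (gapRatio (μ.map π)) atTop (𝓝 ρ) := by
  obtain ⟨c, r, t, hc, hrpos, hr0, hr, htr, ht⟩ := exists_transition hf hμ
  rw [subM22_eq] at hM
  have h11 : pairMatrix f 1 1 = 0 := congrFun (congrFun hM 0) 0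
  have h12 : pairMatrix f 1 2 = a₁ := congrFun (congrFun hM 0) 1
  have h21 : pairMatrix f 2 1 = a₁ := congrFun (congrFun hM 1) 0
  have h22 : pairMatrix f 2 2 = 0 := congrFun (congrFun hM 1) 1
  have hr1 : 0 < r 1 := by
    obtain ⟨x, hx⟩ := wordCyl_pair_nonempty (f := f) (i := 1) (j := 2) (by rw [h12]; exact ha.ne')
    have := hrpos x
    rwa [(mem_wordCyl_cons.1 hx).1] at this
  have hr2 : 0 < r 2 := by
    obtain ⟨x, hx⟩ := wordCyl_pair_nonempty (f := f) (i := 2) (j := 1) (by rw [h21]; exact ha.ne')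
    have := hrpos x
    rwa [(mem_wordCyl_cons.1 hx).1] at this
  have ht11 : t 1 1 = 0 := by rw [htr, h11]; simp
  have ht22 : t 2 2 = 0 := by rw [htr, h22]; simp
  rcases hsym with h | h
  · have h1 := hr 1
    have h2 := hr 2
    rw [Fin.sum_univ_three, h11, h12] at h1
    rw [Fin.sum_univ_three, h21, h22] at h2
    have hrr : r 1 = r 2 := by
      have h3 : (1 + c * a₁) * (r 1 - r 2) = 0 := by
        rw [h] at h1
        linear_combination h2 - h1
      have h4 : (1 + c * a₁) ≠ 0 := by positivity
      exact sub_eq_zero.1 ((mul_eq_zero.1 h3).resolve_left h4)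
    have ht12 : t 1 2 = c * a₁ := by
      rw [htr, h12, hrr]; field_simp
    have ht21 : t 2 1 = c * a₁ := by
      rw [htr, h21, hrr]; field_simp
    have hxy : ∀ a, fiberProb t 1 (List.replicate a 1 ++ [0])
        = fiberProb t 2 (List.replicate a 1 ++ [0]) := by
      intro a
      induction a with
      | zero =>
        rw [List.replicate_zero, List.nil_append, fiberProb_zero, fiberProb_zero, htr, htr, h, hrr]
      | succ a ih =>
        rw [fiberProb_replicate_succ, fiberProb_replicate_succ, ih, ht11, ht22, ht12, ht21]
        ring
    refine hν.exists_limit_of_geometric (b := c * a₁) fun a => ?_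
    rw [hπ.gapMass_succ hμ.1 ht, hπ.gapMass_succ hμ.1 ht, fiberProb_replicate_succ,
      fiberProb_replicate_succ, ht11, ht22, ht12, ht21, hxy]
    ring
  · have hstat : ∀ j, wordMass μ [j] = ∑ i, wordMass μ [i] * t i j := by
      intro j
      rw [← sum_wordMass_cons hμ.1]
      refine Finset.sum_congr rfl fun i _ => ?_
      simpa using ht [] i j
    have h1 := hstat 1
    have h2 := hstat 2
    rw [Fin.sum_univ_three, ht11] at h1
    rw [Fin.sum_univ_three, ht22] at h2
    have ht12 : t 1 2 = c * a₁ * r 2 / r 1 := by rw [htr, h12]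
    have ht21 : t 2 1 = c * a₁ * r 1 / r 2 := by rw [htr, h21]
    obtain ⟨l1, hl1⟩ : ∃ l, wordMass μ [1] = l * r 1 := ⟨wordMass μ [1] / r 1, by field_simp⟩
    obtain ⟨l2, hl2⟩ : ∃ l, wordMass μ [2] = l * r 2 := ⟨wordMass μ [2] / r 2, by field_simp⟩
    have hll : l1 = l2 := by
      set d := wordMass μ [0] * c * pairMatrix f 0 2 / r 0 with hd
      have h3 : wordMass μ [0] * t 0 1 = d * r 1 := by rw [htr, h, hd]; ring
      have h4 : wordMass μ [0] * t 0 2 = d * r 2 := by rw [htr, hd]; ring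
      rw [h3, hl1, hl2, ht21] at h1
      rw [h4, hl1, hl2, ht12] at h2
      have h5 : l1 = d + c * a₁ * l2 := by
        field_simp at h1; linarith
      have h6 : l2 = d + c * a₁ * l1 := by
        field_simp at h2; linarith
      have h7 : (1 + c * a₁) * (l1 - l2) = 0 := by linear_combination h5 - h6
      have h8 : (1 + c * a₁) ≠ 0 := by positivity
      exact sub_eq_zero.1 ((mul_eq_zero.1 h7).resolve_left h8)
    refine hν.exists_limit_of_geometric (b := c * a₁) fun a => ?_
    rw [hπ.gapMass_succ hμ.1 ht, hπ.gapMass_succ hμ.1 ht, fiberProb_replicate_succ,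
      fiberProb_replicate_succ, ht11, ht22, ht12, ht21, hl1, hl2, hll]
    field_simp
    ring

end GapRatios

/-! ### Gibbs potentials from additivity -/

section Assembly

variable {A : Matrix (Fin 3) (Fin 3) ℕ} {B : Matrix (Fin 2) (Fin 2) ℕ} {π : SFT A → SFT B}
  {μ : Measure (SFT A)} {f : SFT A → ℝ}

/-- The measurable and the continuous version of the theorem differ only in the convergence of the
gap ratios. -/
theorem IsOneBlockFactorMap.exists_gibbs_of_additive (hπ : IsOneBlockFactorMap code π)
    (hμ : IsInvariantGibbs μ f) (hν : IsRenewal (μ.map π)) :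
    (AlmostAdditive (relSeq π f) → ∃ g : SFT B → ℝ, Measurable g ∧
      ((∃ ρ > 0, Tendsto (gapRatio (μ.map π)) atTop (𝓝 ρ)) → Continuous g) ∧
      IsUniqueInvariantGibbs (μ.map π) g) ∧
    (WeaklyAlmostAdditive (relSeq π f) → ∃ g : SFT B → ℝ, Measurable g ∧
      ((∃ ρ > 0, Tendsto (gapRatio (μ.map π)) atTop (𝓝 ρ)) → Continuous g) ∧
      IsUniqueInvariantWeakGibbs (μ.map π) g) := by
  obtain ⟨D, hD, hb⟩ := hπ.exists_additivity_iff hμ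
  constructor
  · rintro ⟨C, hC, h⟩
    exact hν.exists_unique_gibbs (c := C + D) (by positivity) fun y n m hn hm =>
      (hb C n m y hn hm).1 (h y n m hn hm)
  · rintro ⟨C, -, hlim, h⟩
    refine hν.exists_unique_weakGibbs (c := fun n => C n + D) ?_ fun y n m hn hm =>
      (hb (C n) n m y hn hm).1 (h y n m hn hm)
    have h1 := hlim.add (tendsto_const_div_atTop_nhds_zero_nat D)
    rw [add_zero] at h1
    exact h1.congr fun n => by ring

end Assembly

end GibbsFactor

open GibbsFactor
theorem theorem4p8
    (A : Matrix (Fin 3) (Fin 3) ℕ) (hA : IsZeroOne A) (hirr : IsIrreducibleShift (SFT A))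
    (B : Matrix (Fin 2) (Fin 2) ℕ) (hB : B = !![1, 1; 1, 1] ∨ B = !![0, 1; 1, 1])
    (π : SFT A → SFT B) (hπ : IsOneBlockFactorMap code π)
    (f : SFT A → ℝ) (hf : IsTwoCoordinate f)
    (μ : Measure (SFT A)) (hμ : IsInvariantGibbs μ f) :
    -- (i)
    ((AlmostAdditive (relSeq π f) ↔
        ∃ g : SFT B → ℝ, Measurable g ∧ IsUniqueInvariantGibbs (μ.map π) g) ∧
      (WeaklyAlmostAdditive (relSeq π f) →
        ∃ g : SFT B → ℝ, Measurable g ∧ IsUniqueInvariantWeakGibbs (μ.map π) g)) ∧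
    -- (ii)
    ((¬ ∃ a₁ a₂ : ℝ, 0 < a₁ ∧ 0 < a₂ ∧ subM22 f = !![0, a₁; a₂, 0]) →
      (AlmostAdditive (relSeq π f) ↔
        ∃ g : SFT B → ℝ, Continuous g ∧ IsUniqueInvariantGibbs (μ.map π) g) ∧
      (WeaklyAlmostAdditive (relSeq π f) →
        ∃ g : SFT B → ℝ, Continuous g ∧ IsUniqueInvariantWeakGibbs (μ.map π) g)) ∧
    -- (iii)
    ((∃ a₁ : ℝ, 0 < a₁ ∧ subM22 f = !![0, a₁; a₁, 0]) →
      (pairMatrix f 1 0 = pairMatrix f 2 0 ∨ pairMatrix f 0 1 = pairMatrix f 0 2) →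
      (AlmostAdditive (relSeq π f) ↔
        ∃ g : SFT B → ℝ, Continuous g ∧ IsUniqueInvariantGibbs (μ.map π) g) ∧
      (WeaklyAlmostAdditive (relSeq π f) →
        ∃ g : SFT B → ℝ, Continuous g ∧ IsUniqueInvariantWeakGibbs (μ.map π) g)) := by
  have hν : IsRenewal (μ.map π) := hπ.isRenewal hB hirr hf hμ
  obtain ⟨h1, h2⟩ := hπ.exists_gibbs_of_additive hμ hν
  have hcont : (∃ ρ > 0, Tendsto (gapRatio (μ.map π)) atTop (𝓝 ρ)) →
      (AlmostAdditive (relSeq π f) ↔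
        ∃ g : SFT B → ℝ, Continuous g ∧ IsUniqueInvariantGibbs (μ.map π) g) ∧
      (WeaklyAlmostAdditive (relSeq π f) →
        ∃ g : SFT B → ℝ, Continuous g ∧ IsUniqueInvariantWeakGibbs (μ.map π) g) := by
    intro hρ
    refine ⟨⟨fun h => ?_, fun ⟨g, _, hg⟩ => hπ.almostAdditive_of_gibbs hμ hg.1⟩, fun h => ?_⟩
    · obtain ⟨g, -, hg, hu⟩ := h1 h
      exact ⟨g, hg hρ, hu⟩
    · obtain ⟨g, -, hg, hu⟩ := h2 h
      exact ⟨g, hg hρ, hu⟩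
  refine ⟨⟨⟨fun h => ?_, fun ⟨g, _, hg⟩ => hπ.almostAdditive_of_gibbs hμ hg.1⟩, fun h => ?_⟩,
    fun h => hcont (hπ.exists_limit_of_not_antidiagonal hf hμ hν h), ?_⟩
  · obtain ⟨g, hg, -, hu⟩ := h1 h
    exact ⟨g, hg, hu⟩
  · obtain ⟨g, hg, -, hu⟩ := h2 h
    exact ⟨g, hg, hu⟩
  · rintro ⟨a₁, ha, hM⟩ hsym
    exact hcont (hπ.exists_limit_of_symmetric hf hμ hν ha hM hsym)
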